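/- Let $(V,Y,\mathbf 1,\omega)$ be a vertex operator algebra over $\mathbb C$, $L(n)=\omega_{n+1}$, and let $z\in\mathbb C^\times$. A $V$-module $W$ is $\mathbb C$-graded by $L(0)$-eigenvalues, $W=\coprod_{h\in\mathbb C}W_{(h)}$, with $\dim W_{(h)}<\infty$ and $W_{(h+n)}=0$ for each $h$ and all sufficiently negative integers $n$; modules for the tensor product vertex operator algebra $V\otimes V$ are defined in the same way. For a linear map $G$ from $V$ to $E[[x,x^{-1}]]$ ($E$ a vector space) put $$G^{o}(v,x)=G\big(e^{xL(1)}(-x^{-2})^{L(0)}v,\,x^{-1}\big).$$ Let $W'=\coprod_h W_{(h)}^*$ be the contragredient module of a $V$-module $W$, with $\langle Y'(v,x)w',w\rangle=\langle w',Y^{o}(v,x)w\rangle$, and let $\overline W=\prod_h W_{(h)}=(W')^*$. The operators $Y^{o}(v,x)$ act on $\overline W$ by $\langle Y^{o}(v,x)\alpha,w'\rangle=\langle\alpha,Y'(v,x)w'\rangle$. *The space $\mathcal D_{Q(z)}(W')$.* It consists of all $\alpha\in (W')^*$ such that for all $v\in V$, $w'\in W'$ the series $\langle\alpha,Y'(v,x)w'\rangle\in\mathbb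 C((x))$ converges absolutely in $0<|x|<|z|$ to a rational function in $\mathbb C[x,x^{-1},(x+z)^{-1}]$ whose orders of poles at $x=-z$ and $x=\infty$ are bounded independently of $w'$ for each fixed $v$. Let $\iota_{x;0}$, $\iota_{x;\infty}$ denote the Laurent expansions of rational functions at $x=0$ and $x=\infty$. For $\alpha\in\mathcal D_{Q(z)}(W')$ define $Y^{L}_{Q(z)}$ and $Y^{R}_{Q(z)}$ by $$\langle (Y^{L}_{Q(z)})^{o}(v,x)\alpha,w'\rangle=\iota_{x;\infty}\big(\iota_{y;0}^{-1}\langle\alpha,Y'(v,y)w'\rangle\big)\big|_{y=x-z},$$ $$\langle Y^{R}_{Q(z)}(v,x)\alpha,w'\rangle=\iota_{x;0}\big(\iota_{y;0}^{-1}\langle\alpha,Y'(v,y)w'\rangle\big)\big|_{y=x-z}.$$ Then $\mathcal D_{Q(z)}(W')$ is a weak $V\otimes V$-module with $Y_{Q(z)}(u\otimes v,x)=Y^{L}_{Q(z)}(u,x)Y^{R}_{Q(z)}(v,x)$. *Intertwining maps.* Let $A$ be a $V\otimes V$-module with vertex operators $Y_A$, and put $Y_1(v,x)=Y_A(v\otimes\mathbf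 1,x)$, $Y_2(v,x)=Y_A(\mathbf 1\otimes v,x)$. A linear map $F:A\to\overline W$ is a *$Q(z)$-intertwining map* if for all $v\in V$, $a\in A$ $$z^{-1}\delta\Big(\frac{x_1-x_0}{z}\Big)Y^{o}(v,x_0)F(a)=x_0^{-1}\delta\Big(\frac{x_1-z}{x_0}\Big)F(Y_1^{o}(v,x_1)a)-x_0^{-1}\delta\Big(\frac{z-x_1}{-x_0}\Big)F(Y_2(v,x_1)a),$$ where $\delta(x)=\sum_{n\in\mathbb Z}x^n$ and powers of binomials are expanded in nonnegative integral powers of the second term. **Theorem.** Let $A$ be a $V\otimes V$-module, $W$ a $V$-module and $F:A\to\overline W=(W')^*$ a linear map. Then $F$ is a $Q(z)$-intertwining map from $A$ to $\overline W$ if and only if $F$ is a $V\otimes V$-homomorphism from $A$ into $\mathcal D_{Q(z)}(W')$, that is, $F(a)\in\mathcal D_{Q(z)}(W')$ and $F(Y_A(t,x)a)=Y_{Q(z)}(t,x)F(a)$ for all $a\in A$ and $t\in V\otimes V$. -/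

import Mathlib

open scoped TensorProduct

noncomputable section

namespace QzMaps

variable {V : Type*} [AddCommGroup V] [Module ℂ V]
variable {M : Type*} [AddCommGroup M] [Module ℂ M]

/-! ### Vertex operator algebras and their modules -/

/-- The operator `v_n` in `Y(v,x) = ∑ v_n x^{-n-1}`.  A `VertexOperator ℂ M` is a linear map from
`M` to `M((x))`, so the truncation condition `Y(v,x)w ∈ M((x))` is part of the type of `Y`. -/
def mode (Y : V →ₗ[ℂ] VertexOperator ℂ M) (v : V) (n : ℤ) : Module.End ℂ M :=
  VertexOperator.ncoeff (Y v) n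

/-- The Jacobi identity
`x₀⁻¹δ((x₁-x₂)/x₀) Y(u,x₁)Y(v,x₂)w - x₀⁻¹δ((x₂-x₁)/(-x₀)) Y(v,x₂)Y(u,x₁)w`
`  = x₂⁻¹δ((x₁-x₀)/x₂) Y(Y(u,x₀)v,x₂)w`,
written as the equality of the coefficients of `x₀^{-r-1} x₁^{-p-1} x₂^{-q-1}` for all integers
`p, q, r`.  All three sums are finite by truncation. -/
def JacobiIdentity (YV : V →ₗ[ℂ] VertexOperator ℂ V) (Y : V →ₗ[ℂ] VertexOperator ℂ M) : Prop :=
  ∀ (u v : V) (w : M) (p q r : ℤ),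
    (∑ᶠ i : ℕ, ((-1 : ℂ) ^ i * (Ring.choose r i : ℤ)) •
        mode Y u (p + r - i) (mode Y v (q + i) w))
      - (-1 : ℂ) ^ r • (∑ᶠ i : ℕ, ((-1 : ℂ) ^ i * (Ring.choose r i : ℤ)) •
        mode Y v (q + r - i) (mode Y u (p + i) w))
    = ∑ᶠ i : ℕ, ((Ring.choose p i : ℤ) : ℂ) • mode Y (mode YV u (r + i) v) (p + q - i) w

/-- `[L(m), L(n)] = (m-n) L(m+n) + (m³-m)/12 δ_{m+n,0} c` for `L(n) = ω_{n+1}`. -/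
def VirasoroRelations (Y : V →ₗ[ℂ] VertexOperator ℂ M) (ω : V) (c : ℂ) : Prop :=
  ∀ m n : ℤ,
    mode Y ω (m + 1) * mode Y ω (n + 1) - mode Y ω (n + 1) * mode Y ω (m + 1)
      = ((m : ℂ) - n) • mode Y ω (m + n + 1)
        + (if m + n = 0 then (((m : ℂ) ^ 3 - m) / 12 * c) else 0) • (1 : Module.End ℂ M)

/-- The data `(Y, 𝟏, ω, rank)` underlying a vertex operator algebra. -/
structure VOAData (V : Type*) [AddCommGroup V] [Module ℂ V] where
  /-- the vertex operator map -/
  Y : V →ₗ[ℂ] VertexOperator ℂ V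
  /-- the vacuum vector -/
  vac : V
  /-- the Virasoro element -/
  conf : V
  /-- the central charge -/
  rank : ℂ

/-- `L(n) = ω_{n+1}` on `V`. -/
def VOAData.L (D : VOAData V) (n : ℤ) : Module.End ℂ V := mode D.Y D.conf (n + 1)

/-- Vertex operator algebras.  The homogeneous subspace `V_(n)` is the eigenspace of `L(0)` with
eigenvalue `n`. -/
structure VOA (V : Type*) [AddCommGroup V] [Module ℂ V] extends VOAData V where
  vacuum : ∀ n : ℤ, mode Y vac n = if n = -1 then 1 else 0
  creation : ∀ (v : V) (n : ℤ), 0 ≤ n → mode Y v n vac = 0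
  creation_lim : ∀ v : V, mode Y v (-1) vac = v
  jacobi : JacobiIdentity Y Y
  virasoro : VirasoroRelations Y conf rank
  /-- `Y(L(-1)v,x) = d/dx Y(v,x)` -/
  derivative : ∀ (v : V) (n : ℤ),
    mode Y (toVOAData.L (-1) v) n = (-(n : ℂ)) • mode Y v (n - 1)
  grading : DirectSum.IsInternal fun n : ℤ => Module.End.eigenspace (toVOAData.L 0) (n : ℂ)
  finite_dim : ∀ n : ℤ, FiniteDimensional ℂ (Module.End.eigenspace (toVOAData.L 0) (n : ℂ))
  bounded_below : ∃ N : ℤ, ∀ n : ℤ, n < N → Module.End.eigenspace (toVOAData.L 0) (n : ℂ) = ⊥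

/-- Weak modules: all axioms of a module except those involving the grading. -/
structure WeakModule (D : VOAData V) (W : Type*) [AddCommGroup W] [Module ℂ W] where
  Y : V →ₗ[ℂ] VertexOperator ℂ W
  vacuum : ∀ n : ℤ, mode Y D.vac n = if n = -1 then 1 else 0
  jacobi : JacobiIdentity D.Y Y
  virasoro : VirasoroRelations Y D.conf D.rank
  /-- `Y(L(-1)v,x) = d/dx Y(v,x)` -/
  derivative : ∀ (v : V) (n : ℤ), mode Y (D.L (-1) v) n = (-(n : ℂ)) • mode Y v (n - 1)

/-- The subspace `W_(h)`, that is, the eigenspace of `L(0)` with eigenvalue `h`. -/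
def WeakModule.weightSpace {D : VOAData V} {W : Type*} [AddCommGroup W] [Module ℂ W]
    (N : WeakModule D W) (h : ℂ) : Submodule ℂ W :=
  Module.End.eigenspace (mode N.Y D.conf 1) h

/-- (Ordinary) modules: `W = ⨁_{h ∈ ℂ} W_(h)` (eigenspaces are always independent), with
`dim W_(h) < ∞` and `W_(h+n) = 0` for every `h` and all sufficiently negative integers `n`. -/
structure OrdModule (D : VOAData V) (W : Type*) [AddCommGroup W] [Module ℂ W]
    extends WeakModule D W where
  grading : ⨆ h : ℂ, toWeakModule.weightSpace h = ⊤
  finite_dim : ∀ h : ℂ, FiniteDimensional ℂ (toWeakModule.weightSpace h)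
  bounded_below : ∀ h : ℂ, ∃ N : ℤ, ∀ n : ℤ, n < N → toWeakModule.weightSpace (h + n) = ⊥

/-! ### The tensor product of two vertex operator algebras -/

section Tensor

variable {V₁ V₂ : Type*} [AddCommGroup V₁] [Module ℂ V₁] [AddCommGroup V₂] [Module ℂ V₂]

/-- The coefficient of `x^n` in `A(x)a`. -/
def lcoeff (A : VertexOperator ℂ M) (n : ℤ) : Module.End ℂ M := HVertexOperator.coeff A n

theorem lcoeff_add (A B : VertexOperator ℂ M) (n : ℤ) :
    lcoeff (A + B) n = lcoeff A n + lcoeff B n := by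
  simp [lcoeff]

theorem lcoeff_smul (c : ℂ) (A : VertexOperator ℂ M) (n : ℤ) :
    lcoeff (c • A) n = c • lcoeff A n := by
  simp [lcoeff]

theorem lcoeff_ext {A B : VertexOperator ℂ M} (h : ∀ n, lcoeff A n = lcoeff B n) : A = B :=
  HVertexOperator.coeff_inj (funext h)

theorem lcoeff_bdd (A : VertexOperator ℂ M) (a : M) : ∃ N : ℤ, ∀ n < N, lcoeff A n a = 0 :=
  ⟨_, fun n hn => by
    have := VertexOperator.coeff_eq_zero_of_lt_order A n a hn
    exact this⟩

theorem tensor_finite (A : VertexOperator ℂ V₁) (B : VertexOperator ℂ V₂) (n : ℤ) (a : V₁)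
    (b : V₂) : (fun i : ℤ => lcoeff A i a ⊗ₜ[ℂ] lcoeff B (n - i) b).support.Finite := by
  obtain ⟨N₁, h₁⟩ := lcoeff_bdd A a
  obtain ⟨N₂, h₂⟩ := lcoeff_bdd B b
  refine (Set.finite_Icc N₁ (n - N₂)).subset fun i hi => ?_
  rw [Function.mem_support] at hi
  constructor
  · by_contra h
    exact hi (by rw [h₁ i (by omega), TensorProduct.zero_tmul])
  · by_contra h
    exact hi (by rw [h₂ (n - i) (by omega), TensorProduct.tmul_zero])

/-- The coefficient of `x^n` in `A(x) ⊗ B(x)`, which sends `a ⊗ b` to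
`∑_{i+j=n} A^i a ⊗ B^j b`, where `A^i` is the coefficient of `x^i` in `A(x)`. -/
def tensorCoeff (A : VertexOperator ℂ V₁) (B : VertexOperator ℂ V₂) (n : ℤ) :
    Module.End ℂ (V₁ ⊗[ℂ] V₂) :=
  TensorProduct.lift <| LinearMap.mk₂ ℂ
    (fun a b => ∑ᶠ i : ℤ, lcoeff A i a ⊗ₜ[ℂ] lcoeff B (n - i) b)
    (fun a a' b => by
      rw [← finsum_add_distrib (tensor_finite A B n a b) (tensor_finite A B n a' b)]
      simp only [map_add, TensorProduct.add_tmul])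
    (fun c a b => by
      rw [smul_finsum]
      simp only [map_smul, TensorProduct.smul_tmul'])
    (fun a b b' => by
      rw [← finsum_add_distrib (tensor_finite A B n a b) (tensor_finite A B n a b')]
      simp only [map_add, TensorProduct.tmul_add])
    (fun c a b => by
      rw [smul_finsum]
      simp only [map_smul, TensorProduct.tmul_smul])

theorem tensorCoeff_tmul (A : VertexOperator ℂ V₁) (B : VertexOperator ℂ V₂) (n : ℤ) (a : V₁)
    (b : V₂) : tensorCoeff A B n (a ⊗ₜ[ℂ] b)
      = ∑ᶠ i : ℤ, lcoeff A i a ⊗ₜ[ℂ] lcoeff B (n - i) b := by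
  simp [tensorCoeff]

theorem tensorCoeff_bdd (A : VertexOperator ℂ V₁) (B : VertexOperator ℂ V₂) (t : V₁ ⊗[ℂ] V₂) :
    ∃ N : ℤ, ∀ n < N, tensorCoeff A B n t = 0 := by
  induction t with
  | zero => exact ⟨0, fun n _ => map_zero _⟩
  | tmul a b =>
    obtain ⟨N₁, h₁⟩ := lcoeff_bdd A a
    obtain ⟨N₂, h₂⟩ := lcoeff_bdd B b
    refine ⟨N₁ + N₂, fun n hn => ?_⟩
    rw [tensorCoeff_tmul]
    refine (finsum_congr fun i => ?_).trans finsum_zero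
    by_cases hi : i < N₁
    · rw [h₁ i hi, TensorProduct.zero_tmul]
    · rw [h₂ (n - i) (by omega), TensorProduct.tmul_zero]
  | add s t hs ht =>
    obtain ⟨N₁, h₁⟩ := hs
    obtain ⟨N₂, h₂⟩ := ht
    refine ⟨min N₁ N₂, fun n hn => ?_⟩
    rw [map_add, h₁ n (lt_of_lt_of_le hn (min_le_left _ _)),
      h₂ n (lt_of_lt_of_le hn (min_le_right _ _)), add_zero]

/-- The vertex operator `A(x) ⊗ B(x)` on `V₁ ⊗ V₂`. -/
def tensorOp (A : VertexOperator ℂ V₁) (B : VertexOperator ℂ V₂) :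
    VertexOperator ℂ (V₁ ⊗[ℂ] V₂) :=
  VertexOperator.of_coeff (tensorCoeff A B) fun t => by
    obtain ⟨N, hN⟩ := tensorCoeff_bdd A B t
    exact ⟨N, fun n hn => by
      by_contra h
      exact hn (hN n (not_le.mp h))⟩

theorem lcoeff_tensorOp (A : VertexOperator ℂ V₁) (B : VertexOperator ℂ V₂) (n : ℤ) :
    lcoeff (tensorOp A B) n = tensorCoeff A B n := rfl

/-- The vertex operator map of `V₁ ⊗ V₂`: `Y(u ⊗ v, x) = Y(u,x) ⊗ Y(v,x)`. -/
def tensorY (Y₁ : V₁ →ₗ[ℂ] VertexOperator ℂ V₁) (Y₂ : V₂ →ₗ[ℂ] VertexOperator ℂ V₂) :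
    (V₁ ⊗[ℂ] V₂) →ₗ[ℂ] VertexOperator ℂ (V₁ ⊗[ℂ] V₂) :=
  TensorProduct.lift <| LinearMap.mk₂ ℂ (fun u v => tensorOp (Y₁ u) (Y₂ v))
    (fun u u' v => lcoeff_ext fun n => TensorProduct.ext' fun a b => by
      rw [lcoeff_add, LinearMap.add_apply]
      simp only [lcoeff_tensorOp, tensorCoeff_tmul]
      rw [← finsum_add_distrib (tensor_finite _ _ n a b) (tensor_finite _ _ n a b)]
      simp only [map_add, lcoeff_add, LinearMap.add_apply, TensorProduct.add_tmul])
    (fun c u v => lcoeff_ext fun n => TensorProduct.ext' fun a b => by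
      rw [lcoeff_smul, LinearMap.smul_apply]
      simp only [lcoeff_tensorOp, tensorCoeff_tmul]
      rw [smul_finsum]
      simp only [map_smul, lcoeff_smul, LinearMap.smul_apply, TensorProduct.smul_tmul'])
    (fun u v v' => lcoeff_ext fun n => TensorProduct.ext' fun a b => by
      rw [lcoeff_add, LinearMap.add_apply]
      simp only [lcoeff_tensorOp, tensorCoeff_tmul]
      rw [← finsum_add_distrib (tensor_finite _ _ n a b) (tensor_finite _ _ n a b)]
      simp only [map_add, lcoeff_add, LinearMap.add_apply, TensorProduct.tmul_add])
    (fun c u v => lcoeff_ext fun n => TensorProduct.ext' fun a b => by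
      rw [lcoeff_smul, LinearMap.smul_apply]
      simp only [lcoeff_tensorOp, tensorCoeff_tmul]
      rw [smul_finsum]
      simp only [map_smul, lcoeff_smul, LinearMap.smul_apply, TensorProduct.tmul_smul])

/-- The vertex operator algebra structure of `V₁ ⊗ V₂`: the vertex operators are
`Y(u ⊗ v, x) = Y(u,x) ⊗ Y(v,x)`, the vacuum is `𝟏 ⊗ 𝟏`, the Virasoro element is
`ω ⊗ 𝟏 + 𝟏 ⊗ ω`, and the central charges add up. -/
def VOAData.tensor (D₁ : VOAData V₁) (D₂ : VOAData V₂) : VOAData (V₁ ⊗[ℂ] V₂) where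
  Y := tensorY D₁.Y D₂.Y
  vac := D₁.vac ⊗ₜ[ℂ] D₂.vac
  conf := D₁.conf ⊗ₜ[ℂ] D₂.vac + D₁.vac ⊗ₜ[ℂ] D₂.conf
  rank := D₁.rank + D₂.rank

end Tensor

/-! ### Opposite operators and the contragredient module -/

/-- The projection of `V = ⨁ V_(k)` onto `V_(k)`. -/
def VOA.proj (𝒱 : VOA V) (k : ℤ) (v : V) : V :=
  ((LinearEquiv.ofBijective (DirectSum.coeLinearMap _) 𝒱.grading).symm v k : V)

/-- `G^o(v,x) = G(e^{xL(1)} (-x⁻²)^{L(0)} v, x⁻¹)` for `G(v,x) = ∑ G(v)_n x^{-n-1}`.  For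
`v ∈ V_(k)` one has
`e^{xL(1)} (-x⁻²)^{L(0)} v = ∑_j (-1)^k / j! x^{j-2k} L(1)^j v`, so that the coefficient of
`x^{-n-1}` in `G^o(v,x)` is `∑_j (-1)^k / j! G(L(1)^j v)_{2k-n-j-2}`. -/
def VOA.opp (𝒱 : VOA V) {E : Type*} [AddCommGroup E] [Module ℂ E] (G : V → ℤ → E)
    (v : V) (n : ℤ) : E :=
  ∑ᶠ k : ℤ, ∑ᶠ j : ℕ,
    ((-1 : ℂ) ^ k / (j.factorial : ℂ)) • G ((𝒱.L 1 ^ j) (𝒱.proj k v)) (2 * k - n - j - 2)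

section Contragredient

variable {W : Type*} [AddCommGroup W] [Module ℂ W]

/-- The restricted dual `W' = ⨁_h W_(h)^*`, realized inside `W^*` as the space of the functionals
that vanish on `W_(h)` for all but finitely many `h`. -/
def WeakModule.restrictedDual {D : VOAData V} (N : WeakModule D W) :
    Submodule ℂ (Module.Dual ℂ W) where
  carrier := {f | {h : ℂ | ∃ w ∈ N.weightSpace h, f w ≠ 0}.Finite}
  zero_mem' := by simp
  add_mem' := by
    intro f g hf hg
    refine (Set.Finite.union hf hg).subset ?_
    rintro h ⟨w, hw, hne⟩
    by_cases h0 : f w = 0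
    · exact Or.inr ⟨w, hw, fun h1 => hne (by simp [h0, h1])⟩
    · exact Or.inl ⟨w, hw, h0⟩
  smul_mem' := by
    intro c f hf
    refine Set.Finite.subset hf ?_
    rintro h ⟨w, hw, hne⟩
    exact ⟨w, hw, fun h0 => hne (by simp [h0])⟩

/-- `[L(0), v_n] = (L(0)v)_n - (n+1) v_n`. -/
theorem L0_comm {D : VOAData V} (N : WeakModule D W) (v : V) (n : ℤ) (w : W) :
    mode N.Y D.conf 1 (mode N.Y v n w) - mode N.Y v n (mode N.Y D.conf 1 w)
      = mode N.Y (D.L 0 v) n w - ((n : ℂ) + 1) • mode N.Y v n w := by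
  have h := N.jacobi D.conf v w 1 n 0
  have e0 : ∀ f : ℕ → W, (∑ᶠ i : ℕ, ((-1 : ℂ) ^ i * (Ring.choose (0 : ℤ) i : ℤ)) • f i) = f 0 := by
    intro f
    rw [finsum_eq_single _ 0 (fun i hi => by
      obtain ⟨j, rfl⟩ := Nat.exists_eq_succ_of_ne_zero hi
      rw [Ring.choose_zero_succ]; simp)]
    simp
  have e1 : ∀ f : ℕ → W, (∑ᶠ i : ℕ, ((Ring.choose (1 : ℤ) i : ℤ) : ℂ) • f i) = f 0 + f 1 := by
    intro f
    have hc : ∀ i : ℕ, Ring.choose (1 : ℤ) i = ((Nat.choose 1 i : ℕ) : ℤ) := fun i => by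
      have := Ring.choose_natCast (R := ℤ) 1 i
      simpa using this
    rw [finsum_eq_sum_of_support_subset (s := Finset.range 2) _ (fun i hi => by
      rw [Function.mem_support] at hi
      simp only [Finset.coe_range, Set.mem_Iio]
      by_contra h2
      exact hi (by rw [hc, Nat.choose_eq_zero_of_lt (by omega)]; simp))]
    simp [Finset.sum_range_succ, hc]
  rw [e0, e0, e1] at h
  have hd := N.derivative v (1 + n)
  have hL : mode D.Y D.conf (0 + ((0 : ℕ) : ℤ)) v = D.L (-1) v := by simp [VOAData.L]
  have hL' : mode D.Y D.conf (0 + ((1 : ℕ) : ℤ)) v = D.L 0 v := by simp [VOAData.L]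
  rw [hL, hL'] at h
  simp only [Nat.cast_zero, Nat.cast_one, add_zero, sub_zero, zpow_zero, one_smul] at h
  rw [hd] at h
  simp only [add_sub_cancel_left, LinearMap.smul_apply] at h
  rw [h]
  push_cast
  module

/-- If `v ∈ V_(k)` then `v_n` maps `W_(h)` into `W_(h+k-n-1)`. -/
theorem mode_weight {D : VOAData V} (N : WeakModule D W) {k : ℂ} {v : V}
    (hv : v ∈ Module.End.eigenspace (D.L 0) k) (n : ℤ) {h : ℂ} {w : W}
    (hw : w ∈ N.weightSpace h) : mode N.Y v n w ∈ N.weightSpace (h + (k - n - 1)) := by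
  have e := L0_comm N v n w
  rw [WeakModule.weightSpace, Module.End.mem_eigenspace_iff] at hw ⊢
  rw [Module.End.mem_eigenspace_iff] at hv
  have hs : mode N.Y (k • v) n w = k • mode N.Y v n w := by
    simp [mode]
  rw [hw, hv, map_smul, hs, sub_eq_iff_eq_add] at e
  rw [e]
  module

theorem VOA.proj_mem (𝒱 : VOA V) (k : ℤ) (v : V) :
    𝒱.proj k v ∈ Module.End.eigenspace (𝒱.L 0) (k : ℂ) :=
  ((LinearEquiv.ofBijective (DirectSum.coeLinearMap _) 𝒱.grading).symm v k).2

theorem VOA.L1_pow_mem (𝒱 : VOA V) {k : ℂ} {v : V}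
    (hv : v ∈ Module.End.eigenspace (𝒱.L 0) k) (j : ℕ) :
    (𝒱.L 1 ^ j) v ∈ Module.End.eigenspace (𝒱.L 0) (k - j) := by
  induction j with
  | zero => simpa using hv
  | succ j ih =>
    rw [pow_succ', Module.End.mul_apply]
    have h := congrArg (fun T => T ((𝒱.L 1 ^ j) v)) (𝒱.virasoro 0 1)
    rw [Module.End.mem_eigenspace_iff] at ih ⊢
    simp only [VOAData.L] at ih h ⊢
    simp only [zero_add, LinearMap.sub_apply, Module.End.mul_apply,
      LinearMap.smul_apply, one_ne_zero, if_false, zero_smul, add_zero] at h ih ⊢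
    rw [ih, map_smul, sub_eq_iff_eq_add] at h
    rw [h]
    push_cast
    module

/-- The transposes of the operators `v^o_n` preserve `W'`. -/
theorem dualMap_opp_mem (𝒱 : VOA V) (N : WeakModule 𝒱.toVOAData W) (v : V) (n : ℤ)
    (f : Module.Dual ℂ W) (hf : f ∈ N.restrictedDual) :
    (𝒱.opp (mode N.Y) v n).dualMap f ∈ N.restrictedDual := by
  rw [VOA.opp]
  refine finsum_induction (fun T : Module.End ℂ W => T.dualMap f ∈ N.restrictedDual) ?_ ?_
    fun k => ?_
  · change f ∘ₗ (0 : Module.End ℂ W) ∈ _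
    rw [LinearMap.comp_zero]
    exact Submodule.zero_mem _
  · intro S T hS hT
    change f ∘ₗ (S + T) ∈ _
    rw [LinearMap.comp_add]
    exact Submodule.add_mem _ hS hT
  · refine finsum_induction (fun T : Module.End ℂ W => T.dualMap f ∈ N.restrictedDual) ?_ ?_
      fun j => ?_
    · change f ∘ₗ (0 : Module.End ℂ W) ∈ _
      rw [LinearMap.comp_zero]
      exact Submodule.zero_mem _
    · intro S T hS hT
      change f ∘ₗ (S + T) ∈ _
      rw [LinearMap.comp_add]
      exact Submodule.add_mem _ hS hT
    · change f ∘ₗ (_ • mode N.Y _ _) ∈ _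
      rw [LinearMap.comp_smul]
      refine Submodule.smul_mem _ _ ?_
      have hm := 𝒱.L1_pow_mem (𝒱.proj_mem k v) j
      refine Set.Finite.subset (hf.preimage
        (f := fun h => h + ((k : ℂ) - j - ((2 * k - n - j - 2 : ℤ) : ℂ) - 1))
        (fun a _ b _ hab => add_right_cancel hab)) ?_
      rintro h ⟨w, hw, hne⟩
      exact ⟨_, mode_weight N hm _ hw, hne⟩

/-- The vertex operators `Y'(v,x) = ∑ v'_n x^{-n-1}` of the contragredient module `W'`, given by
`⟨Y'(v,x)w', w⟩ = ⟨w', Y^o(v,x)w⟩`. -/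
def contragredient (𝒱 : VOA V) (N : WeakModule 𝒱.toVOAData W) (v : V) (n : ℤ) :
    Module.End ℂ N.restrictedDual :=
  (𝒱.opp (mode N.Y) v n).dualMap.restrict (dualMap_opp_mem 𝒱 N v n)

end Contragredient

/-! ### Rational functions and their expansions -/

theorem le_comap_aeval {g : RatFunc ℂ} (hg : Transcendental ℂ g) :
    nonZeroDivisors (Polynomial ℂ) ≤
      (nonZeroDivisors (RatFunc ℂ)).comap (Polynomial.aeval g : Polynomial ℂ →ₐ[ℂ] RatFunc ℂ) :=
  nonZeroDivisors_le_comap_nonZeroDivisors_of_injective _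
    (transcendental_iff_injective.mp hg)

/-- Substitution `f(x) ↦ f(g(x))` for a non-constant rational function `g`. -/
def subst (g : RatFunc ℂ) (hg : Transcendental ℂ g) : RatFunc ℂ →ₐ[ℂ] RatFunc ℂ :=
  RatFunc.liftAlgHom (Polynomial.aeval g) (le_comap_aeval hg)

theorem transcendental_inv : Transcendental ℂ ((RatFunc.X : RatFunc ℂ)⁻¹) := fun h =>
  RatFunc.transcendental_X (IsAlgebraic.inv_iff.mp h)

theorem transcendental_shift (z : ℂ) : Transcendental ℂ ((RatFunc.X : RatFunc ℂ) - RatFunc.C z) :=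
  fun h => RatFunc.transcendental_X (K := ℂ) <| by
    have h2 := h.add (isAlgebraic_algebraMap (A := RatFunc ℂ) z)
    rwa [RatFunc.algebraMap_eq_C, sub_add_cancel] at h2

/-- `f(x) ↦ f(x⁻¹)`. -/
def invX : RatFunc ℂ →ₐ[ℂ] RatFunc ℂ := subst _ transcendental_inv

/-- `f(x) ↦ f(x - z)`. -/
def shiftX (z : ℂ) : RatFunc ℂ →ₐ[ℂ] RatFunc ℂ := subst _ (transcendental_shift z)

open scoped RatFunc in
/-- The embedding `ℂ(x) → ℂ((x))` given by Laurent expansion at `x = 0`. -/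
def laurent : RatFunc ℂ →+* LaurentSeries ℂ := algebraMap (RatFunc ℂ) (LaurentSeries ℂ)

open scoped RatFunc in
theorem laurent_algebraMap (p : Polynomial ℂ) :
    laurent (algebraMap (Polynomial ℂ) (RatFunc ℂ) p)
      = algebraMap (Polynomial ℂ) (LaurentSeries ℂ) p :=
  (IsScalarTower.algebraMap_apply (Polynomial ℂ) (RatFunc ℂ) (LaurentSeries ℂ) p).symm

/-- `ι_{x;0}`: the Laurent expansion at `x = 0`, as an element of `ℂ[[x,x⁻¹]]`; the value at
`n : ℤ` is the coefficient of `x^n`. -/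
def iotaZero : RatFunc ℂ →ₗ[ℂ] (ℤ → ℂ) where
  toFun f n := (laurent f).coeff n
  map_add' f g := by
    ext n
    simp
  map_smul' c f := by
    ext n
    have hC : algebraMap (Polynomial ℂ) (LaurentSeries ℂ) (Polynomial.C c) = HahnSeries.C c := by
      simp
    rw [RatFunc.smul_eq_C_mul, map_mul, ← RatFunc.algebraMap_C, laurent_algebraMap, hC]
    simp

theorem iotaZero_injective : Function.Injective iotaZero := fun f g h =>
  laurent.injective (HahnSeries.ext h)

/-- `ι_{x;∞}`: the Laurent expansion at `x = ∞`, that is,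
`ι_{x;∞} f(x) = (ι_{y;0} f(y⁻¹))|_{y=x⁻¹}`. -/
def iotaInf : RatFunc ℂ →ₗ[ℂ] (ℤ → ℂ) where
  toFun f n := iotaZero (invX f) (-n)
  map_add' f g := by
    ext n
    rw [map_add, map_add]
    rfl
  map_smul' c f := by
    ext n
    have h : invX (c • f) = c • invX f := invX.toLinearMap.map_smul c f
    rw [h, map_smul]
    rfl

/-! ### `Q(z)`-linear functionals -/

/-- The series `⟨α, Y(v,x)w⟩`, linear in `w`; the value at `n` is the coefficient of `x^n`.  Here
`Y(v,x) = ∑ Y(v)_n x^{-n-1}`. -/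
def matSeries (Y : V → ℤ → Module.End ℂ M) (α : Module.Dual ℂ M) (v : V) : M →ₗ[ℂ] (ℤ → ℂ) :=
  LinearMap.pi fun n => α ∘ₗ Y v (-n - 1)

/-- The condition on a fixed `v` in the definition of a `Q(z)`-linear functional: for every `w`
the series `⟨α, Y(v,x)w⟩` converges absolutely in `0 < |x| < |z|` to a rational function
`p(x) / (x^k (x+z)^l)` whose pole at `-z` has order at most `l` and whose pole at `∞` has order at
most `m`, where `l` and `m` do not depend on `w`. -/
def QLinearAt (Y : V → ℤ → Module.End ℂ M) (z : ℂ) (α : Module.Dual ℂ M) (v : V) : Prop :=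
  ∃ l m : ℕ, ∀ w : M, ∃ (k : ℕ) (p : Polynomial ℂ), p.natDegree ≤ k + l + m ∧
    ∀ x : ℂ, 0 < ‖x‖ → ‖x‖ < ‖z‖ →
      HasSum (fun n : ℤ => matSeries Y α v w n * x ^ n) (p.eval x / (x ^ k * (x + z) ^ l))

/-- The space `𝒟_{Q(z)}(M)` of `Q(z)`-linear functionals. -/
def DQ (Y : V → ℤ → Module.End ℂ M) (z : ℂ) : Submodule ℂ (Module.Dual ℂ M) where
  carrier := {α | ∀ v : V, QLinearAt Y z α v}
  zero_mem' := fun v => ⟨0, 0, fun w => ⟨0, 0, by simp, fun x _ _ => by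
    simp [matSeries, hasSum_zero]⟩⟩
  add_mem' := by
    intro α β hα hβ v
    obtain ⟨l₁, m₁, h₁⟩ := hα v
    obtain ⟨l₂, m₂, h₂⟩ := hβ v
    refine ⟨l₁ + l₂, m₁ + m₂, fun w => ?_⟩
    obtain ⟨k₁, p₁, d₁, s₁⟩ := h₁ w
    obtain ⟨k₂, p₂, d₂, s₂⟩ := h₂ w
    have hdeg : ∀ (k l : ℕ), ((Polynomial.X ^ k * (Polynomial.X + Polynomial.C z) ^ l :
        Polynomial ℂ)).natDegree ≤ k + l := by
      intro k l
      refine Polynomial.natDegree_mul_le.trans ?_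
      refine add_le_add (by simp) (Polynomial.natDegree_pow_le.trans ?_)
      rw [Polynomial.natDegree_X_add_C, mul_one]
    refine ⟨k₁ + k₂, p₁ * (Polynomial.X ^ k₂ * (Polynomial.X + Polynomial.C z) ^ l₂)
      + p₂ * (Polynomial.X ^ k₁ * (Polynomial.X + Polynomial.C z) ^ l₁), ?_, fun x hx hz => ?_⟩
    · refine Polynomial.natDegree_add_le_of_degree_le ?_ ?_
      · have := (Polynomial.natDegree_mul_le (p := p₁)
          (q := Polynomial.X ^ k₂ * (Polynomial.X + Polynomial.C z) ^ l₂))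
        have := hdeg k₂ l₂
        omega
      · have := (Polynomial.natDegree_mul_le (p := p₂)
          (q := Polynomial.X ^ k₁ * (Polynomial.X + Polynomial.C z) ^ l₁))
        have := hdeg k₁ l₁
        omega
    · have hx0 : x ≠ 0 := norm_pos_iff.mp hx
      have hxz : x + z ≠ 0 := fun h => by
        rw [eq_neg_of_add_eq_zero_left h, norm_neg] at hz
        exact lt_irrefl _ hz
      convert! (s₁ x hx hz).add (s₂ x hx hz) using 1
      · ext n
        simp [matSeries, add_mul]
      · simp only [Polynomial.eval_add, Polynomial.eval_mul, Polynomial.eval_pow,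
          Polynomial.eval_X, Polynomial.eval_C]
        field_simp
        ring
  smul_mem' := by
    intro c α hα v
    obtain ⟨l, m, h⟩ := hα v
    refine ⟨l, m, fun w => ?_⟩
    obtain ⟨k, p, d, s⟩ := h w
    refine ⟨k, c • p, (Polynomial.natDegree_smul_le c p).trans d, fun x hx hz => ?_⟩
    convert! (s x hx hz).mul_left c using 1
    · ext n
      simp [matSeries, mul_assoc]
    · rw [Polynomial.eval_smul, smul_eq_mul, mul_div_assoc]

open Classical in
/-- The rational function `ι_{x;0}⁻¹ ⟨α, Y(v,x)w⟩`, linear in `w`.  (It exists for all `v`, `w`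
when `α ∈ 𝒟_{Q(z)}(M)`, the only case in which it is used; the value is `0` otherwise.) -/
def ratFun (Y : V → ℤ → Module.End ℂ M) (α : Module.Dual ℂ M) (v : V) : M →ₗ[ℂ] RatFunc ℂ :=
  if h : ∀ w, matSeries Y α v w ∈ LinearMap.range iotaZero then
    (LinearEquiv.ofInjective iotaZero iotaZero_injective).symm.toLinearMap ∘ₗ
      (matSeries Y α v).codRestrict _ h
  else 0

/-- The coefficient of `x^{-n-1}` in `(Y^L_{Q(z)})^o(v,x)α`, where
`⟨(Y^L_{Q(z)})^o(v,x)α, w⟩ = ι_{x;∞} ((ι_{y;0}⁻¹ ⟨α, Y(v,y)w⟩)|_{y=x-z})`. -/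
def YLo (Y : V → ℤ → Module.End ℂ M) (z : ℂ) (α : Module.Dual ℂ M) (v : V) (n : ℤ) :
    Module.Dual ℂ M :=
  LinearMap.proj (-n - 1) ∘ₗ iotaInf ∘ₗ (shiftX z).toLinearMap ∘ₗ ratFun Y α v

/-- The coefficient of `x^{-n-1}` in `Y^L_{Q(z)}(v,x)α`; by `(G^o)^o = G` the operator is obtained
from `(Y^L_{Q(z)})^o` by passing to the opposite operator once more. -/
def YL (𝒱 : VOA V) (Y : V → ℤ → Module.End ℂ M) (z : ℂ) (v : V) (n : ℤ) (α : Module.Dual ℂ M) :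
    Module.Dual ℂ M :=
  𝒱.opp (YLo Y z α) v n

/-- The coefficient of `x^{-n-1}` in `Y^R_{Q(z)}(v,x)α`, where
`⟨Y^R_{Q(z)}(v,x)α, w⟩ = ι_{x;0} ((ι_{y;0}⁻¹ ⟨α, Y(v,y)w⟩)|_{y=x-z})`. -/
def YR (Y : V → ℤ → Module.End ℂ M) (z : ℂ) (v : V) (n : ℤ) (α : Module.Dual ℂ M) :
    Module.Dual ℂ M :=
  LinearMap.proj (-n - 1) ∘ₗ iotaZero ∘ₗ (shiftX z).toLinearMap ∘ₗ ratFun Y α v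

/-- The coefficient of `x^{-n-1}` in
`Y_{Q(z)}(u ⊗ v, x)α = Y^L_{Q(z)}(u,x) Y^R_{Q(z)}(v,x)α`, namely the sum of
`u^L_i v^R_j α` over `i + j = n - 1`; for `α ∈ 𝒟_{Q(z)}(M)` the sum is finite. -/
def YQ (𝒱 : VOA V) (Y : V → ℤ → Module.End ℂ M) (z : ℂ) (u v : V) (n : ℤ)
    (α : Module.Dual ℂ M) : Module.Dual ℂ M :=
  ∑ᶠ i : ℤ, YL 𝒱 Y z u i (YR Y z v (n - 1 - i) α)

/-! ### Homomorphisms and intertwining maps -/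

section Maps

variable {A : Type*} [AddCommGroup A] [Module ℂ A] {W : Type*} [AddCommGroup W] [Module ℂ W]

/-- `F : A → (W')^*` is a `V ⊗ V`-homomorphism from `A` into `𝒟_{Q(z)}(W') ⊆ (W')^*`: its values
lie in `𝒟_{Q(z)}(W')`, and `F(Y_A(t,x)a) = Y_{Q(z)}(t,x)F(a)` for every element
`t = ∑ u ⊗ v` of `V ⊗ V`, that is, for every finite sum of pure tensors, on which `Y_{Q(z)}` is
given by linearity. -/
def IsHomIntoDQ (𝒱 : VOA V) (N : WeakModule (𝒱.tensor 𝒱.toVOAData) A)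
    (P : WeakModule 𝒱.toVOAData W) (z : ℂ) (F : A →ₗ[ℂ] Module.Dual ℂ P.restrictedDual) : Prop :=
  (∀ a : A, F a ∈ DQ (contragredient 𝒱 P) z) ∧
  ∀ (s : List (V × V)) (n : ℤ) (a : A),
    F (mode N.Y (s.map fun t => t.1 ⊗ₜ[ℂ] t.2).sum n a)
      = (s.map fun t => YQ 𝒱 (contragredient 𝒱 P) z t.1 t.2 n (F a)).sum

/-- `Y₁(v,x) = Y_A(v ⊗ 𝟏, x)`, by its modes. -/
def Y₁ (𝒱 : VOA V) (N : WeakModule (𝒱.tensor 𝒱.toVOAData) A) (v : V) (n : ℤ) :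
    Module.End ℂ A :=
  mode N.Y (v ⊗ₜ[ℂ] 𝒱.vac) n

/-- `Y₂(v,x) = Y_A(𝟏 ⊗ v, x)`, by its modes. -/
def Y₂ (𝒱 : VOA V) (N : WeakModule (𝒱.tensor 𝒱.toVOAData) A) (v : V) (n : ℤ) :
    Module.End ℂ A :=
  mode N.Y (𝒱.vac ⊗ₜ[ℂ] v) n

/-- `Q(z)`-intertwining maps `F : A → W̄ = (W')^*`: for all `v`, `a`,
`z⁻¹δ((x₁-x₀)/z) F(a)Y'(v,x₀)`
`  = x₀⁻¹δ((x₁-z)/x₀) F(Y₁^o(v,x₁)a) - x₀⁻¹δ((z-x₁)/(-x₀)) F(Y₂(v,x₁)a)`,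
where `F(a)Y'(v,x₀) = Y^o(v,x₀)F(a)` for the action of `Y^o(v,x₀)` on `W̄`.  The identity is
evaluated at `w' ∈ W'` and written as the equality of the coefficients of
`x₀^{-r-1} x₁^{-p-1}` for all integers `p, r`, where (all sums over `i ≥ 0`)
`z⁻¹δ((x₁-x₀)/z) = ∑_s ∑_i (-1)^i C(s,i) z^{-s-1} x₁^{s-i} x₀^i` contributes with
`s = i - p - 1` and `(-1)^i C(i-p-1,i) = C(p,i)`,
`x₀⁻¹δ((x₁-z)/x₀) = ∑_r ∑_i (-z)^i C(r,i) x₀^{-r-1} x₁^{r-i}`, and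
`x₀⁻¹δ((z-x₁)/(-x₀)) = ∑_r ∑_i (-1)^{r+i} C(r,i) z^{r-i} x₀^{-r-1} x₁^i`.
All three sums are finite by truncation. -/
def IsQzIntertwining (𝒱 : VOA V) (N : WeakModule (𝒱.tensor 𝒱.toVOAData) A)
    (P : WeakModule 𝒱.toVOAData W) (z : ℂ) (F : A →ₗ[ℂ] Module.Dual ℂ P.restrictedDual) : Prop :=
  ∀ (v : V) (a : A) (w' : P.restrictedDual) (p r : ℤ),
    (∑ᶠ i : ℕ, ((Ring.choose p i : ℤ) : ℂ) * z ^ (p - i) *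
        F a (contragredient 𝒱 P v (r + i) w'))
    = (∑ᶠ i : ℕ, (-z) ^ i * ((Ring.choose r i : ℤ) : ℂ) *
        F (𝒱.opp (Y₁ 𝒱 N) v (p + r - i) a) w')
      - ∑ᶠ i : ℕ, (-1 : ℂ) ^ r * (-1) ^ i * ((Ring.choose r i : ℤ) : ℂ) * z ^ (r - i) *
        F (Y₂ 𝒱 N v (p + i) a) w'

end Maps

end QzMaps

end

noncomputable section

namespace QzMaps

/-! Fix `v`, `a` and `w'`, and write `g(y)` for the series `⟨F(a), Y'(v,y)w'⟩`. If `g` is rational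
with poles only at `0`, `-z` and `∞`, the form `x^p (x-z)^r g(x-z) dx` has poles only at `z`, `0`
and `∞`. The coefficients of the intertwining identity are then exactly its residue theorem for all
integers `p` and `r`, provided that `F(Y₁^o(v,x)a)` and `F(Y₂(v,x)a)` are the expansions of `g(x-z)`
at `∞` and at `0`. These two expansions are what `Y^L_{Q(z)}` (in opposite form) and `Y^R_{Q(z)}`
are made of. Hence a homomorphism is an intertwining map (`QLinearAt.defect_eq_zero`).

Conversely, suppose the identity holds. The modes of `Y₂` and of `Y₁^o` applied to `a` are
truncated, with bounds that do not involve `w'`. Taking `p` large removes the `Y₂` term, and taking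
`r` very negative afterwards removes the `Y₁^o` term. What remains says that `(y+z)^p g(y)` is a
Laurent polynomial. So `g` is rational, it converges for `0 < |y| < |z|`, and its pole orders at
`-z` and `∞` are bounded uniformly in `w'` (`qLinearAt_of_defect`). Finally `g` determines the other
two series, since the identity with zero left side has no nonzero truncated solutions
(`eq_of_defect`); by the residue theorem those series are the two expansions of `g(x-z)`.

The residue theorem is proved algebraically. Multiplying `g` by `y` or by `y+z` only shifts `r` or
`p`, so the case `g = 1` gives all polynomials, and then all quotients by powers of `y` and `y+z`.
Passing between convergent series and rational functions uses the identity theorem for power series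
and the geometric series of `(y+z)⁻¹`.

Two formal facts finish the proof. The rule `(G^o)^o = G` (`VOA.opp_opp`) turns the condition on
`Y₁^o` into one on `Y₁`. The factorization `Y_A(u ⊗ v,x) = Y₁(u,x)Y₂(v,x)` (`mode_tmul`), together
with the vacuum property, reduces homomorphisms of `V ⊗ V` to compatibility with `Y₁` and `Y₂`
separately. -/

/-! ### Binomial transforms of sequences -/

/-- Sequences that vanish at all large integers. -/
def TailZero (c : ℤ → ℂ) : Prop := ∃ N : ℤ, ∀ n, N ≤ n → c n = 0

/-- The coefficient at `s` of the product of the binomial expansion of `(a + b x)^p` in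
nonnegative powers of `b x` with the sequence `c`. -/
def binomSum (p : ℤ) (a b : ℂ) (c : ℤ → ℂ) (s : ℤ) : ℂ :=
  ∑ᶠ i : ℕ, ((Ring.choose p i : ℤ) : ℂ) * a ^ (p - i) * b ^ i * c (s + i)

theorem binomSum_eq_sum {c : ℤ → ℂ} {N : ℤ} (hc : ∀ n, N ≤ n → c n = 0) (p : ℤ) (a b : ℂ) (s : ℤ)
    (M : ℕ) (hM : N ≤ s + M) : binomSum p a b c s
      = ∑ i ∈ Finset.range M, ((Ring.choose p i : ℤ) : ℂ) * a ^ (p - i) * b ^ i * c (s + i) := by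
  refine finsum_eq_sum_of_support_subset _ fun i hi => ?_
  rw [Function.mem_support] at hi
  simp only [Finset.coe_range, Set.mem_Iio]
  by_contra h
  exact hi (by rw [hc _ (by omega), mul_zero])

theorem binomSum_of_tail {c : ℤ → ℂ} {s : ℤ} (hc : ∀ n, s ≤ n → c n = 0) (p : ℤ) (a b : ℂ) :
    binomSum p a b c s = 0 := by
  rw [binomSum_eq_sum hc p a b s 0 (by simp), Finset.sum_range_zero]

theorem binomSum_of_tail_succ {c : ℤ → ℂ} {s : ℤ} (hc : ∀ n, s + 1 ≤ n → c n = 0) (p : ℤ)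
    (a b : ℂ) : binomSum p a b c s = a ^ p * c s := by
  rw [binomSum_eq_sum hc p a b s 1 (by simp), Finset.sum_range_one]
  simp

theorem exists_range_bound (N s : ℤ) : ∃ M : ℕ, N ≤ s + M := ⟨(N - s).toNat, by omega⟩

theorem binomSum_zero_exponent (a b : ℂ) (c : ℤ → ℂ) (s : ℤ) : binomSum 0 a b c s = c s := by
  rw [binomSum, finsum_eq_single _ 0 fun i hi => ?_]
  · simp
  · obtain ⟨j, rfl⟩ := Nat.exists_eq_succ_of_ne_zero hi
    rw [Ring.choose_zero_succ]
    simp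

theorem binomSum_add {c d : ℤ → ℂ} (hc : TailZero c) (hd : TailZero d) (p : ℤ) (a b : ℂ) (s : ℤ) :
    binomSum p a b (fun n => c n + d n) s = binomSum p a b c s + binomSum p a b d s := by
  obtain ⟨N₁, h₁⟩ := hc
  obtain ⟨N₂, h₂⟩ := hd
  obtain ⟨M, hM⟩ := exists_range_bound (max N₁ N₂) s
  rw [binomSum_eq_sum h₁ p a b s M (by omega), binomSum_eq_sum h₂ p a b s M (by omega),
    binomSum_eq_sum (N := max N₁ N₂) (fun n hn => by
      rw [h₁ n (by omega), h₂ n (by omega), add_zero]) p a b s M hM, ← Finset.sum_add_distrib]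
  exact Finset.sum_congr rfl fun i _ => mul_add _ _ _

theorem binomSum_mul_left {c : ℤ → ℂ} (hc : TailZero c) (e : ℂ) (p : ℤ) (a b : ℂ) (s : ℤ) :
    binomSum p a b (fun n => e * c n) s = e * binomSum p a b c s := by
  obtain ⟨N, h⟩ := hc
  obtain ⟨M, hM⟩ := exists_range_bound N s
  rw [binomSum_eq_sum h p a b s M hM,
    binomSum_eq_sum (N := N) (fun n hn => by rw [h n hn, mul_zero]) p a b s M hM, Finset.mul_sum]
  exact Finset.sum_congr rfl fun i _ => by ring

theorem binomSum_shift (c : ℤ → ℂ) (p : ℤ) (a b : ℂ) (s k : ℤ) :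
    binomSum p a b (fun n => c (n + k)) s = binomSum p a b c (s + k) :=
  finsum_congr fun i => by dsimp only; rw [show s + (i : ℤ) + k = s + k + i by ring]

theorem TailZero.add {c d : ℤ → ℂ} (hc : TailZero c) (hd : TailZero d) :
    TailZero fun n => c n + d n := by
  obtain ⟨N₁, h₁⟩ := hc
  obtain ⟨N₂, h₂⟩ := hd
  exact ⟨max N₁ N₂, fun n hn => by simp [h₁ n (by omega), h₂ n (by omega)]⟩

theorem TailZero.mul_left {c : ℤ → ℂ} (hc : TailZero c) (e : ℂ) : TailZero fun n => e * c n := by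
  obtain ⟨N, h⟩ := hc
  exact ⟨N, fun n hn => by simp [h n hn]⟩

theorem TailZero.shift {c : ℤ → ℂ} (hc : TailZero c) (k : ℤ) : TailZero fun n => c (n + k) := by
  obtain ⟨N, h⟩ := hc
  exact ⟨N - k, fun n hn => h _ (by omega)⟩

/-- Pascal's rule, that is, `(a + bx)^{p+1} = (a + bx)(a + bx)^p`. Exponents are arbitrary integers,
so `a` has to be invertible. -/
theorem binomSum_succ {c : ℤ → ℂ} (hc : TailZero c) (p : ℤ) {a : ℂ} (ha : a ≠ 0) (b : ℂ) (s : ℤ) :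
    binomSum (p + 1) a b c s = a * binomSum p a b c s + b * binomSum p a b c (s + 1) := by
  obtain ⟨N, h⟩ := hc
  obtain ⟨M, hM⟩ := exists_range_bound N s
  rw [binomSum_eq_sum h (p + 1) a b s (M + 1) (by push_cast; omega),
    binomSum_eq_sum h p a b s (M + 1) (by push_cast; omega),
    binomSum_eq_sum h p a b (s + 1) M (by omega), Finset.sum_range_succ', Finset.sum_range_succ',
    mul_add, Finset.mul_sum, Finset.mul_sum, add_right_comm, ← Finset.sum_add_distrib]
  congr 1
  · refine Finset.sum_congr rfl fun i _ => ?_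
    rw [Ring.choose_succ_succ, show s + 1 + (i : ℤ) = s + ((i + 1 : ℕ) : ℤ) by push_cast; ring,
      show p + 1 - ((i + 1 : ℕ) : ℤ) = p - ((i + 1 : ℕ) : ℤ) + 1 by ring,
      show p - (i : ℤ) = p - ((i + 1 : ℕ) : ℤ) + 1 by push_cast; ring, zpow_add_one₀ ha]
    push_cast
    ring
  · simp [zpow_add_one₀ ha]
    ring

theorem binomSum_succ' {c : ℤ → ℂ} (hc : TailZero c) (p : ℤ) {a : ℂ} (ha : a ≠ 0) (b : ℂ)
    (s : ℤ) :
    binomSum (p + 1) a b c s = binomSum p a b (fun n => a * c n + b * c (n + 1)) s := by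
  rw [binomSum_succ hc p ha, binomSum_add (hc.mul_left a) ((hc.shift 1).mul_left b),
    binomSum_mul_left hc, binomSum_mul_left (hc.shift 1), binomSum_shift]

/-! ### The three-term identity -/

/-- The difference of the two sides of the coefficient of `x₀^{-r-1} x₁^{-p-1}` in the defining
identity of a `Q(z)`-intertwining map, for the sequences of modes `c`, `R`, and `l` of
`Y^o(v,x₀)`, `Y₂(v,x₁)`, and, in the opposite order, of `Y₁^o(v,x₁)`. -/
def defect (z : ℂ) (c l R : ℤ → ℂ) (p r : ℤ) : ℂ :=
  binomSum p z 1 c r - binomSum r 1 (-z) l (-(p + r)) + binomSum r (-z) 1 R p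

section

variable {z : ℂ} {c l R c' l' R' : ℤ → ℂ}

theorem defect_add (hc : TailZero c) (hl : TailZero l) (hR : TailZero R) (hc' : TailZero c')
    (hl' : TailZero l') (hR' : TailZero R') (p r : ℤ) :
    defect z (fun n => c n + c' n) (fun n => l n + l' n) (fun n => R n + R' n) p r
      = defect z c l R p r + defect z c' l' R' p r := by
  simp only [defect, binomSum_add hc hc', binomSum_add hl hl', binomSum_add hR hR']
  ring

theorem defect_mul_left (hc : TailZero c) (hl : TailZero l) (hR : TailZero R) (e : ℂ) (p r : ℤ) :
    defect z (fun n => e * c n) (fun n => e * l n) (fun n => e * R n) p r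
      = e * defect z c l R p r := by
  simp only [defect, binomSum_mul_left hc, binomSum_mul_left hl, binomSum_mul_left hR]
  ring

/-- The exponents `p` and `r` belong to `x` and `x - z`, and `z = x - (x - z)`. -/
theorem defect_recursion (hz : z ≠ 0) (hc : TailZero c) (hl : TailZero l) (hR : TailZero R)
    (p r : ℤ) :
    z * defect z c l R p r = defect z c l R (p + 1) r - defect z c l R p (r + 1) := by
  simp only [defect]
  rw [binomSum_succ hc p hz, binomSum_succ hl r one_ne_zero, binomSum_succ hR r (neg_ne_zero.2 hz),
    show -(p + (r + 1)) + 1 = -(p + r) by ring, show -(p + 1 + r) = -(p + (r + 1)) by ring]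
  ring

/-- Multiplication of the underlying function by `x₁`. -/
theorem defect_succ_left (hz : z ≠ 0) (hc : TailZero c) (p r : ℤ) :
    defect z (fun n => z * c n + c (n + 1)) (fun n => l (n - 1)) (fun n => R (n + 1)) p r
      = defect z c l R (p + 1) r := by
  have h := binomSum_succ' hc p hz 1 r
  simp only [one_mul] at h
  have hl := binomSum_shift l r 1 (-z) (-(p + r)) (-1)
  simp only [← sub_eq_add_neg] at hl
  simp only [defect]
  rw [h, hl, binomSum_shift R, show -(p + 1 + r) = -(p + r) - 1 by ring]

/-- Multiplication of the underlying function by `x₁ - z`. -/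
theorem defect_succ_right (hz : z ≠ 0) (hl : TailZero l) (hR : TailZero R) (p r : ℤ) :
    defect z (fun n => c (n + 1)) (fun n => l (n - 1) - z * l n) (fun n => R (n + 1) - z * R n) p r
      = defect z c l R p (r + 1) := by
  have h := binomSum_succ' hR r (neg_ne_zero.2 hz) 1 p
  have e := binomSum_shift (fun n => l (n - 1) - z * l n) r 1 (-z) (-(p + (r + 1))) 1
  have h' := binomSum_succ' hl r one_ne_zero (-z) (-(p + (r + 1)))
  rw [show -(p + (r + 1)) + 1 = -(p + r) by ring] at e
  simp only [defect]
  rw [binomSum_shift c, h, h', ← e]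
  congr 2
  · congr 1
    ext n
    ring_nf
  · ext n
    ring

/-- The three-term identity with `c = 0` has no nonzero solutions. -/
theorem eq_zero_of_defect (hl : TailZero l) (hR : TailZero R)
    (h : ∀ p r, defect z (fun _ => 0) l R p r = 0) : (∀ n, l n = 0) ∧ ∀ n, R n = 0 := by
  have h0 : ∀ p r, binomSum p z 1 (fun _ => 0) r = 0 := fun p r =>
    binomSum_of_tail (fun _ _ => rfl) p z 1
  obtain ⟨N, hN⟩ := hl
  obtain ⟨K, hK⟩ := hR
  have key : ∀ k : ℕ, ∀ m, N - k ≤ m → l m = 0 := by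
    intro k
    induction k with
    | zero => exact fun m hm => hN m (by simpa using hm)
    | succ k ih =>
      intro m hm
      -- With `p = K` the `R` sum lies entirely in its tail. The choice of `r` makes the `l` sum
      -- start at `m`, and by induction only its leading term survives, with coefficient `1`.
      have e := h K (-m - K)
      rw [defect, h0, binomSum_of_tail hK, show -(K + (-m - K)) = m by ring,
        binomSum_of_tail_succ fun n hn => ih n (by push_cast at hm; omega)] at e
      simpa using e
  have hl : ∀ n, l n = 0 := fun n => key (N - n).toNat n (by omega)
  refine ⟨hl, fun n => ?_⟩
  -- At `r = 0` both binomial sums collapse to one term, which relates `R n` to `l (-n)`.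
  have e := h n 0
  rw [defect, h0, binomSum_zero_exponent, binomSum_zero_exponent, hl] at e
  simpa using e

/-- The three-term identity determines `l` and `R` from `c`. -/
theorem eq_of_defect (hc : TailZero c) (hl : TailZero l) (hR : TailZero R) (hl' : TailZero l')
    (hR' : TailZero R') (h : ∀ p r, defect z c l R p r = 0)
    (h' : ∀ p r, defect z c l' R' p r = 0) : l = l' ∧ R = R' := by
  have key := eq_zero_of_defect (z := z) (hl.add (hl'.mul_left (-1)))
    (hR.add (hR'.mul_left (-1))) fun p r => by
      have e := defect_add (z := z) hc hl hR (hc.mul_left (-1)) (hl'.mul_left (-1))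
        (hR'.mul_left (-1)) p r
      rw [defect_mul_left hc hl' hR', h, h'] at e
      simpa using e
  exact ⟨funext fun n => by linear_combination key.1 n, funext fun n => by
    linear_combination key.2 n⟩

end

/-! ### Expansions of rational functions -/

theorem subst_X (g : RatFunc ℂ) (hg : Transcendental ℂ g) : subst g hg RatFunc.X = g := by
  rw [subst, ← RatFunc.algebraMap_X]
  have := RatFunc.liftAlgHom_apply_div (φ := (Polynomial.aeval g : Polynomial ℂ →ₐ[ℂ] RatFunc ℂ))
    (le_comap_aeval hg) Polynomial.X 1
  simpa using this

theorem subst_C (g : RatFunc ℂ) (hg : Transcendental ℂ g) (a : ℂ) :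
    subst g hg (RatFunc.C a) = RatFunc.C a := by
  rw [← RatFunc.algebraMap_eq_C]
  exact AlgHom.commutes _ a

theorem invX_X : invX RatFunc.X = RatFunc.X⁻¹ := subst_X _ _

theorem shiftX_X (z : ℂ) : shiftX z RatFunc.X = RatFunc.X - RatFunc.C z := subst_X _ _

theorem shiftX_C (z a : ℂ) : shiftX z (RatFunc.C a) = RatFunc.C a := subst_C _ _ a

theorem laurent_X : laurent RatFunc.X = HahnSeries.single 1 1 := by
  rw [← RatFunc.algebraMap_X, laurent_algebraMap]
  simp

theorem iotaZero_X_mul (f : RatFunc ℂ) (n : ℤ) :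
    iotaZero (RatFunc.X * f) n = iotaZero f (n - 1) := by
  change (laurent _).coeff n = (laurent f).coeff (n - 1)
  rw [map_mul, laurent_X]
  have := HahnSeries.coeff_single_mul_add (r := (1:ℂ)) (x := laurent f) (a := n - 1) (b := 1)
  simpa using this

theorem iotaZero_C_mul (a : ℂ) (f : RatFunc ℂ) (n : ℤ) :
    iotaZero (RatFunc.C a * f) n = a * iotaZero f n := by
  rw [← RatFunc.smul_eq_C_mul, map_smul, Pi.smul_apply, smul_eq_mul]

theorem iotaInf_X_mul (f : RatFunc ℂ) (n : ℤ) :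
    iotaInf (RatFunc.X * f) n = iotaInf f (n - 1) := by
  change iotaZero (invX _) (-n) = iotaZero (invX f) (-(n - 1))
  have h := iotaZero_X_mul (RatFunc.X⁻¹ * invX f) (-(n - 1))
  rw [mul_inv_cancel_left₀ RatFunc.X_ne_zero] at h
  rw [h, map_mul, invX_X, show -(n - 1) - 1 = -n by ring]

theorem iotaInf_C_mul (a : ℂ) (f : RatFunc ℂ) (n : ℤ) :
    iotaInf (RatFunc.C a * f) n = a * iotaInf f n := by
  rw [← RatFunc.smul_eq_C_mul, map_smul, Pi.smul_apply, smul_eq_mul]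

theorem iotaZero_eq_zero_of_lt (f : RatFunc ℂ) : ∃ N : ℤ, ∀ n < N, iotaZero f n = 0 :=
  ⟨(laurent f).order, fun _ hn => HahnSeries.coeff_eq_zero_of_lt_order hn⟩

theorem iotaZero_one (n : ℤ) : iotaZero 1 n = if n = 0 then 1 else 0 := by
  change (laurent 1).coeff n = _
  rw [map_one, HahnSeries.coeff_one]
  split_ifs <;> rfl

theorem iotaInf_one (n : ℤ) : iotaInf 1 n = if n = 0 then 1 else 0 := by
  change iotaZero (invX 1) (-n) = _
  rw [map_one, iotaZero_one]
  exact if_congr neg_eq_zero rfl rfl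

/-- The coefficient of `y^{-n-1}` in the expansion of `g(y)` at `y = 0`. -/
def modeZero (g : RatFunc ℂ) (n : ℤ) : ℂ := iotaZero g (-n - 1)

/-- The coefficient of `x^{n-1}` in the expansion of `g(x-z)` at `x = ∞`. -/
def modeInf (z : ℂ) (g : RatFunc ℂ) (n : ℤ) : ℂ := iotaInf (shiftX z g) (n - 1)

theorem tailZero_modeZero (g : RatFunc ℂ) : TailZero (modeZero g) := by
  obtain ⟨N, h⟩ := iotaZero_eq_zero_of_lt g
  exact ⟨-N, fun n hn => h _ (by omega)⟩

theorem tailZero_modeInf (z : ℂ) (g : RatFunc ℂ) : TailZero (modeInf z g) := by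
  obtain ⟨N, h⟩ := iotaZero_eq_zero_of_lt (invX (shiftX z g))
  exact ⟨-N + 2, fun n hn => h _ (by omega)⟩

/-- The rational functions whose expansions satisfy the three-term identity. -/
def ResidueIdentity (z : ℂ) (g : RatFunc ℂ) : Prop :=
  ∀ p r, defect z (modeZero g) (modeInf z g) (modeZero (shiftX z g)) p r = 0

section

variable {z : ℂ} {g h : RatFunc ℂ}

theorem ResidueIdentity.add (hg : ResidueIdentity z g) (hh : ResidueIdentity z h) :
    ResidueIdentity z (g + h) := fun p r => by
  have e := defect_add (z := z) (tailZero_modeZero g) (tailZero_modeInf z g)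
    (tailZero_modeZero (shiftX z g)) (tailZero_modeZero h) (tailZero_modeInf z h)
    (tailZero_modeZero (shiftX z h)) p r
  rw [hg, hh, add_zero] at e
  rw [← e]
  congr 1 <;> ext n <;> simp only [modeZero, modeInf, map_add, Pi.add_apply]

theorem ResidueIdentity.C_mul (hg : ResidueIdentity z g) (a : ℂ) :
    ResidueIdentity z (RatFunc.C a * g) := fun p r => by
  have e := defect_mul_left (z := z) (tailZero_modeZero g) (tailZero_modeInf z g)
    (tailZero_modeZero (shiftX z g)) a p r
  rw [hg, mul_zero] at e
  rw [← e]
  congr 1 <;> ext n <;> simp only [modeZero, modeInf, map_mul, shiftX_C, iotaZero_C_mul, iotaInf_C_mul]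

/-- After the substitution `y = x - z` the factor `y + z` is `x`, which raises the exponent `p` by
one in all three terms. -/
theorem defect_X_add_C_mul (hz : z ≠ 0) (g : RatFunc ℂ) (p r : ℤ) :
    defect z (modeZero ((RatFunc.X + RatFunc.C z) * g)) (modeInf z ((RatFunc.X + RatFunc.C z) * g))
      (modeZero (shiftX z ((RatFunc.X + RatFunc.C z) * g))) p r
    = defect z (modeZero g) (modeInf z g) (modeZero (shiftX z g)) (p + 1) r := by
  rw [← defect_succ_left hz (tailZero_modeZero g)]
  have hs : shiftX z ((RatFunc.X + RatFunc.C z) * g) = RatFunc.X * shiftX z g := by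
    rw [map_mul, map_add, shiftX_X, shiftX_C, sub_add_cancel]
  congr 1 <;> ext n
  · simp only [modeZero, add_mul, map_add, Pi.add_apply, iotaZero_X_mul, iotaZero_C_mul]
    rw [add_comm, show -n - 1 - 1 = -(n + 1) - 1 by ring]
  · simp only [modeInf, hs, iotaInf_X_mul]
  · simp only [modeZero, hs, iotaZero_X_mul]
    rw [show -n - 1 - 1 = -(n + 1) - 1 by ring]

theorem defect_X_mul (hz : z ≠ 0) (g : RatFunc ℂ) (p r : ℤ) :
    defect z (modeZero (RatFunc.X * g)) (modeInf z (RatFunc.X * g))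
      (modeZero (shiftX z (RatFunc.X * g))) p r
    = defect z (modeZero g) (modeInf z g) (modeZero (shiftX z g)) p (r + 1) := by
  rw [← defect_succ_right hz (tailZero_modeInf z g) (tailZero_modeZero (shiftX z g))]
  have hs : shiftX z (RatFunc.X * g) = RatFunc.X * shiftX z g - RatFunc.C z * shiftX z g := by
    rw [map_mul, shiftX_X, sub_mul]
  congr 1 <;> ext n
  · simp only [modeZero, iotaZero_X_mul]
    rw [show -n - 1 - 1 = -(n + 1) - 1 by ring]
  · simp only [modeInf, hs, map_sub, Pi.sub_apply, iotaInf_X_mul, iotaInf_C_mul]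
  · simp only [modeZero, hs, map_sub, Pi.sub_apply, iotaZero_X_mul, iotaZero_C_mul]
    rw [show -n - 1 - 1 = -(n + 1) - 1 by ring]

theorem ResidueIdentity.X_mul (hz : z ≠ 0) (hg : ResidueIdentity z g) :
    ResidueIdentity z (RatFunc.X * g) := fun p r => by rw [defect_X_mul hz, hg]

/-- Since `r` runs over all integers, multiplication by `X` merely reindexes the family of
identities and can be undone. -/
theorem ResidueIdentity.of_X_pow_mul (hz : z ≠ 0) (k : ℕ)
    (hg : ResidueIdentity z (RatFunc.X ^ k * g)) : ResidueIdentity z g := by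
  induction k with
  | zero => simpa using hg
  | succ k ih =>
    refine ih fun p r => ?_
    have := hg p (r - 1)
    rwa [pow_succ', mul_assoc, defect_X_mul hz, sub_add_cancel] at this

theorem ResidueIdentity.of_X_add_C_pow_mul (hz : z ≠ 0) (k : ℕ)
    (hg : ResidueIdentity z ((RatFunc.X + RatFunc.C z) ^ k * g)) : ResidueIdentity z g := by
  induction k with
  | zero => simpa using hg
  | succ k ih =>
    refine ih fun p r => ?_
    have := hg (p - 1) r
    rwa [pow_succ', mul_assoc, defect_X_add_C_mul hz, sub_add_cancel] at this

/-- The defect vanishes on both axes `p = 0` and `r = 0`, where it can be computed directly. The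
recursion `z ρ(p,r) = ρ(p+1,r) - ρ(p,r+1)` spreads this over the whole lattice. -/
theorem residueIdentity_one (hz : z ≠ 0) : ResidueIdentity z 1 := by
  set ρ := defect z (modeZero 1) (modeInf z 1) (modeZero (shiftX z 1)) with hρ
  have hrec : ∀ p r, z * ρ p r = ρ (p + 1) r - ρ p (r + 1) :=
    defect_recursion hz (tailZero_modeZero _) (tailZero_modeInf _ _) (tailZero_modeZero _)
  have hc : ∀ n, modeZero 1 n = if n = -1 then 1 else 0 := fun n => by
    rw [modeZero, iotaZero_one]
    exact if_congr (by omega) rfl rfl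
  have hl : ∀ n, modeInf z 1 n = if n = 1 then 1 else 0 := fun n => by
    rw [modeInf, map_one, iotaInf_one]
    exact if_congr (by omega) rfl rfl
  have hs : ∀ n, 0 ≤ n → modeZero 1 n = 0 := fun n hn => by rw [hc, if_neg (by omega)]
  have h0 : ∀ p, ρ p 0 = 0 := fun p => by
    rw [hρ, defect, binomSum_of_tail hs, binomSum_zero_exponent, binomSum_zero_exponent, hl,
      map_one, hc]
    split_ifs <;> first | omega | simp
  have h0' : ∀ r, ρ 0 r = 0 := fun r => by
    rw [hρ, defect, map_one, binomSum_of_tail hs, binomSum_zero_exponent, hc]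
    rcases lt_trichotomy r (-1) with h | rfl | h
    · rw [if_neg (by omega), binomSum_of_tail fun n hn => by rw [hl, if_neg (by omega)]]
      simp
    · rw [if_pos rfl, binomSum_of_tail_succ fun n hn => by rw [hl, if_neg (by omega)], hl]
      simp
    -- The only nonzero value of `l`, at `1`, is met at `i = r + 1`, where `C(r, r+1) = 0`.
    · lift r to ℕ using by omega with r
      rw [if_neg (by omega), binomSum, finsum_eq_single _ (r + 1) fun i hi => by
        rw [hl, if_neg (by omega), mul_zero]]
      rw [Ring.choose_natCast, Nat.choose_succ_self]
      simp
  have hpos : ∀ p : ℕ, ∀ r, ρ p r = 0 := by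
    intro p
    induction p with
    | zero => exact h0'
    | succ p ih =>
      intro r
      have := hrec p r
      rw [ih, ih] at this
      push_cast
      simpa using this.symm
  -- For negative `p` the row above vanishes, so the recursion links neighbours within a row: `z
  -- ρ(p,r) = -ρ(p,r+1)`. As `z ≠ 0`, the zero at `r = 0` propagates in both directions.
  have hneg : ∀ p : ℕ, ∀ r, ρ (-p) r = 0 := by
    intro p
    induction p with
    | zero => simpa using h0'
    | succ p ih =>
      have step : ∀ r, z * ρ (-(p + 1 : ℕ)) r = -ρ (-(p + 1 : ℕ)) (r + 1) := fun r => by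
        rw [hrec, show (-((p + 1 : ℕ) : ℤ) + 1) = -p by push_cast; ring, ih, zero_sub]
      intro r
      induction r using Int.induction_on with
      | zero => exact h0 _
      | succ r h =>
        have := step r
        rw [h] at this
        simpa using this.symm
      | pred r h =>
        have := step (-r - 1)
        rw [sub_add_cancel, h, neg_zero] at this
        exact (mul_eq_zero.1 this).resolve_left hz
  intro p r
  rcases Int.eq_nat_or_neg p with ⟨m, rfl | rfl⟩
  · exact hpos m r
  · exact hneg m r

theorem residueIdentity_polynomial (hz : z ≠ 0) (q : Polynomial ℂ) :
    ResidueIdentity z (algebraMap (Polynomial ℂ) (RatFunc ℂ) q) := by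
  induction q using Polynomial.induction_on' with
  | add p q hp hq =>
    rw [map_add]
    exact hp.add hq
  | monomial n a =>
    rw [← Polynomial.C_mul_X_pow_eq_monomial, map_mul, map_pow, RatFunc.algebraMap_C,
      RatFunc.algebraMap_X]
    refine ResidueIdentity.C_mul ?_ a
    induction n with
    | zero => simpa using residueIdentity_one hz
    | succ n ih =>
      rw [pow_succ']
      exact ih.X_mul hz

/-- The residue theorem for rational functions with poles at most at `0`, `-z` and `∞`. -/
theorem residueIdentity_of_mul_eq (hz : z ≠ 0) {k l : ℕ} {q : Polynomial ℂ}
    (h : RatFunc.X ^ k * ((RatFunc.X + RatFunc.C z) ^ l * g)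
      = algebraMap (Polynomial ℂ) (RatFunc ℂ) q) : ResidueIdentity z g :=
  ResidueIdentity.of_X_add_C_pow_mul hz l <| ResidueIdentity.of_X_pow_mul hz k <|
    h ▸ residueIdentity_polynomial hz q

end

/-! ### Absolutely convergent power series -/

/-- Absolute convergence of the power series `A` at `x`. -/
def AbsConv (A : PowerSeries ℂ) (x : ℂ) : Prop :=
  Summable fun n : ℕ => ‖PowerSeries.coeff n A * x ^ n‖

/-- The sum of the power series `A` at `x`. -/
def evalSum (A : PowerSeries ℂ) (x : ℂ) : ℂ := ∑' n : ℕ, PowerSeries.coeff n A * x ^ n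

section

variable {A B : PowerSeries ℂ} {x z : ℂ}

theorem coeff_mul_mul_pow (A B : PowerSeries ℂ) (x : ℂ) (n : ℕ) :
    PowerSeries.coeff n (A * B) * x ^ n = ∑ kl ∈ Finset.HasAntidiagonal.antidiagonal n,
      (PowerSeries.coeff kl.1 A * x ^ kl.1) * (PowerSeries.coeff kl.2 B * x ^ kl.2) := by
  rw [PowerSeries.coeff_mul, Finset.sum_mul]
  refine Finset.sum_congr rfl fun kl hkl => ?_
  rw [← Finset.HasAntidiagonal.mem_antidiagonal.1 hkl, pow_add]
  ring

theorem AbsConv.mul (hA : AbsConv A x) (hB : AbsConv B x) : AbsConv (A * B) x := by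
  refine (summable_norm_sum_mul_antidiagonal_of_summable_norm hA hB).congr fun n => ?_
  rw [coeff_mul_mul_pow]

theorem evalSum_mul (hA : AbsConv A x) (hB : AbsConv B x) :
    evalSum (A * B) x = evalSum A x * evalSum B x := by
  simp only [evalSum, coeff_mul_mul_pow]
  exact (tsum_mul_tsum_eq_tsum_sum_antidiagonal_of_summable_norm hA hB).symm

theorem AbsConv.sub (hA : AbsConv A x) (hB : AbsConv B x) : AbsConv (A - B) x := by
  refine (Summable.add hA hB).of_nonneg_of_le (fun _ => norm_nonneg _) fun n => ?_
  rw [map_sub, sub_mul]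
  exact norm_sub_le _ _

theorem evalSum_sub (hA : AbsConv A x) (hB : AbsConv B x) :
    evalSum (A - B) x = evalSum A x - evalSum B x := by
  rw [evalSum, evalSum, evalSum, ← hA.of_norm.tsum_sub hB.of_norm]
  exact tsum_congr fun n => by rw [map_sub, sub_mul]

theorem absConv_polynomial (p : Polynomial ℂ) (x : ℂ) : AbsConv (p : PowerSeries ℂ) x := by
  refine summable_of_ne_finset_zero (s := Finset.range (p.natDegree + 1)) fun n hn => ?_
  rw [Polynomial.coeff_coe, Polynomial.coeff_eq_zero_of_natDegree_lt (by simpa using hn)]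
  simp

theorem evalSum_polynomial (p : Polynomial ℂ) (x : ℂ) :
    evalSum (p : PowerSeries ℂ) x = p.eval x := by
  rw [evalSum, Polynomial.eval_eq_sum_range, tsum_eq_sum (s := Finset.range (p.natDegree + 1))]
  · simp only [Polynomial.coeff_coe]
  · intro n hn
    rw [Polynomial.coeff_coe, Polynomial.coeff_eq_zero_of_natDegree_lt (by simpa using hn),
      zero_mul]

/-- The geometric series `(x + z)⁻¹ = ∑ (-1)^n z^{-n-1} x^n`. -/
def geomSeries (z : ℂ) : PowerSeries ℂ := PowerSeries.mk fun n => z⁻¹ * (-z⁻¹) ^ n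

theorem geomSeries_mul (hz : z ≠ 0) :
    ((Polynomial.X + Polynomial.C z : Polynomial ℂ) : PowerSeries ℂ) * geomSeries z = 1 := by
  rw [Polynomial.coe_add, Polynomial.coe_X, Polynomial.coe_C, add_mul]
  ext n
  rcases n with _ | n
  · simp [geomSeries, hz]
  · rw [map_add, PowerSeries.coeff_succ_X_mul, PowerSeries.coeff_C_mul, geomSeries,
      PowerSeries.coeff_mk, PowerSeries.coeff_mk, PowerSeries.coeff_one, if_neg n.succ_ne_zero,
      pow_succ]
    field_simp
    ring

theorem absConv_geomSeries (hz : z ≠ 0) (hx : ‖x‖ < ‖z‖) : AbsConv (geomSeries z) x := by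
  have h : ‖-z⁻¹ * x‖ < 1 := by
    rw [norm_mul, norm_neg, norm_inv, inv_mul_lt_iff₀ (norm_pos_iff.2 hz), mul_one]
    exact hx
  have := (summable_geometric_of_norm_lt_one h).norm.mul_left ‖z⁻¹‖
  refine this.congr fun n => ?_
  rw [geomSeries, PowerSeries.coeff_mk, ← norm_mul, mul_pow]
  ring_nf

theorem AbsConv.pow (hA : AbsConv A x) (l : ℕ) : AbsConv (A ^ l) x := by
  induction l with
  | zero =>
    rw [pow_zero, ← Polynomial.coe_one]
    exact absConv_polynomial 1 x
  | succ l ih =>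
    rw [pow_succ]
    exact ih.mul hA

/-- A power series whose product with `(x+z)^l` is a polynomial converges absolutely for
`|x| < |z|`. -/
theorem absConv_of_mul_eq (hz : z ≠ 0) (hx : ‖x‖ < ‖z‖) {l : ℕ} {p : Polynomial ℂ}
    (h : (((Polynomial.X + Polynomial.C z) ^ l : Polynomial ℂ) : PowerSeries ℂ) * A = p) :
    AbsConv A x := by
  have hA : A = geomSeries z ^ l * p := by
    rw [← h, Polynomial.coe_pow, ← mul_assoc, ← mul_pow, mul_comm (geomSeries z),
      geomSeries_mul hz, one_pow, one_mul]
  rw [hA]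
  exact ((absConv_geomSeries hz hx).pow l).mul (absConv_polynomial p x)

theorem evalSum_X_pow_mul (n : ℕ) (hA : AbsConv A x) :
    evalSum (PowerSeries.X ^ n * A) x = x ^ n * evalSum A x := by
  have h := absConv_polynomial (Polynomial.X ^ n) x
  have e := evalSum_polynomial (Polynomial.X ^ n) x
  rw [Polynomial.coe_pow, Polynomial.coe_X] at h e
  rw [evalSum_mul h hA, e]
  simp

theorem AbsConv.of_X_pow_mul {n : ℕ} (hx : x ≠ 0) (hA : AbsConv (PowerSeries.X ^ n * A) x) :
    AbsConv A x := by
  have := ((summable_nat_add_iff n).2 hA).mul_left ‖(x ^ n)⁻¹‖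
  refine this.congr fun m => ?_
  rw [PowerSeries.coeff_X_pow_mul, ← norm_mul, pow_add]
  congr 1
  field_simp

/-- A power series that converges to `0` in a punctured disc vanishes. -/
theorem eq_zero_of_evalSum {ρ : ℝ} (hρ : 0 < ρ) (hA : ∀ x : ℂ, 0 < ‖x‖ → ‖x‖ < ρ → AbsConv A x)
    (h0 : ∀ x : ℂ, 0 < ‖x‖ → ‖x‖ < ρ → evalSum A x = 0) : A = 0 := by
  by_contra hne
  -- Divide out the order of vanishing; a nonzero constant term must then contradict the vanishing
  -- of the sum near `0`.
  obtain ⟨n, B, hB, hAB⟩ : ∃ (n : ℕ) (B : PowerSeries ℂ), PowerSeries.constantCoeff B ≠ 0 ∧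
      A = PowerSeries.X ^ n * B :=
    ⟨_, A.divXPowOrder, PowerSeries.constantCoeff_divXPowOrder_eq_zero_iff.not.2 hne, PowerSeries.X_pow_order_mul_divXPowOrder.symm⟩
  have hBc : ∀ x : ℂ, 0 < ‖x‖ → ‖x‖ < ρ → AbsConv B x := fun x h1 h2 =>
    AbsConv.of_X_pow_mul (n := n) (norm_pos_iff.1 h1) (hAB ▸ hA x h1 h2)
  have hB0 : ∀ x : ℂ, 0 < ‖x‖ → ‖x‖ < ρ → evalSum B x = 0 := fun x h1 h2 => by
    have := h0 x h1 h2
    rw [hAB, evalSum_X_pow_mul n (hBc x h1 h2)] at this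
    exact (mul_eq_zero.1 this).resolve_left (pow_ne_zero _ (norm_pos_iff.1 h1))
  obtain ⟨s, hs0, hsρ⟩ := exists_between hρ
  have hns : ‖(s : ℂ)‖ = s := by simp [abs_of_pos hs0]
  have hsum := (summable_nat_add_iff 1).2 (hBc s (by rwa [hns]) (by rwa [hns]))
  set K := ∑' n : ℕ, ‖PowerSeries.coeff (n + 1) B * (s : ℂ) ^ (n + 1)‖
  -- At the point `ts` the constant term is minus the sum of the other terms, each of which is at
  -- most `t` times its size at `s`, because `t^{n+1} ≤ t`.
  have bound : ∀ t : ℝ, 0 < t → t < 1 → ‖PowerSeries.coeff 0 B‖ ≤ t * K := by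
    intro t ht ht1
    have hnt : ‖((t * s : ℝ) : ℂ)‖ = t * s := by simp [abs_of_pos hs0, abs_of_pos ht]
    have h1 : 0 < ‖((t * s : ℝ) : ℂ)‖ := by rw [hnt]; positivity
    have h2 : ‖((t * s : ℝ) : ℂ)‖ < ρ := by rw [hnt]; nlinarith
    have e := hB0 _ h1 h2
    have hc := hBc _ h1 h2
    rw [evalSum, hc.of_norm.tsum_eq_zero_add, pow_zero, mul_one] at e
    rw [eq_neg_of_add_eq_zero_left e, norm_neg, ← tsum_mul_left]
    refine tsum_of_norm_bounded (hsum.mul_left t).hasSum fun n => ?_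
    rw [Complex.ofReal_mul, mul_pow, norm_mul, norm_mul, norm_mul, norm_pow, norm_pow,
      Complex.norm_of_nonneg ht.le]
    have : t ^ (n + 1) ≤ t := pow_le_of_le_one ht.le ht1.le n.succ_ne_zero
    have h3 := mul_le_mul_of_nonneg_right this
      (by positivity : 0 ≤ ‖PowerSeries.coeff (n + 1) B‖ * ‖(s : ℂ)‖ ^ (n + 1))
    linarith
  have hpos : 0 < ‖PowerSeries.coeff 0 B‖ := norm_pos_iff.2 (by simpa using hB)
  have hK : 0 ≤ K := tsum_nonneg fun _ => norm_nonneg _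
  have := bound (min (1 / 2) (‖PowerSeries.coeff 0 B‖ / (2 * (K + 1)))) (by positivity)
    (lt_of_le_of_lt (min_le_left _ _) (by norm_num))
  have h4 := mul_le_mul_of_nonneg_right (min_le_right (1 / 2 : ℝ)
    (‖PowerSeries.coeff 0 B‖ / (2 * (K + 1)))) hK
  have h5 : ‖PowerSeries.coeff 0 B‖ / (2 * (K + 1)) * K < ‖PowerSeries.coeff 0 B‖ := by
    rw [div_mul_eq_mul_div, div_lt_iff₀ (by positivity)]
    nlinarith
  linarith

end

/-! ### Laurent series of rational functions with poles at `0` and `-z` -/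

theorem laurent_polynomial (p : Polynomial ℂ) :
    laurent (algebraMap (Polynomial ℂ) (RatFunc ℂ) p)
      = HahnSeries.ofPowerSeries ℤ ℂ (p : PowerSeries ℂ) := by
  rw [laurent_algebraMap, Polynomial.algebraMap_hahnSeries_apply]

/-- The power series `x^K f(x)` for a Laurent series `f` with lowest exponent at least `-K`. -/
def powPart (f : ℤ → ℂ) (K : ℕ) : PowerSeries ℂ := PowerSeries.mk fun n => f (n - K)

/-- The denominator `x^k (x+z)^l`. -/
def poleDenom (z : ℂ) (k l : ℕ) : Polynomial ℂ :=
  Polynomial.X ^ k * (Polynomial.X + Polynomial.C z) ^ l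

theorem poleDenom_ne_zero (z : ℂ) (k l : ℕ) : poleDenom z k l ≠ 0 :=
  mul_ne_zero (pow_ne_zero _ Polynomial.X_ne_zero)
    (pow_ne_zero _ (Polynomial.X_add_C_ne_zero z))

theorem eval_poleDenom (z x : ℂ) (k l : ℕ) : (poleDenom z k l).eval x = x ^ k * (x + z) ^ l := by
  simp [poleDenom]

section

variable {f : ℤ → ℂ} {K : ℕ} {z : ℂ} {k l : ℕ} {p : Polynomial ℂ}

theorem laurent_eq_iff (hf : ∀ n < -(K : ℤ), f n = 0) (g : RatFunc ℂ) :
    iotaZero g = f ↔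
      laurent g = HahnSeries.single (-K : ℤ) 1 * HahnSeries.ofPowerSeries ℤ ℂ (powPart f K) := by
  have key : ∀ n, (HahnSeries.single (-K : ℤ) 1 *
      HahnSeries.ofPowerSeries ℤ ℂ (powPart f K)).coeff n = f n := by
    intro n
    have h := HahnSeries.coeff_single_mul_add (r := (1 : ℂ))
      (x := HahnSeries.ofPowerSeries ℤ ℂ (powPart f K)) (a := n + K) (b := -K)
    rw [add_neg_cancel_right, one_mul] at h
    rw [h]
    have h2 := PowerSeries.coeff_coe (powPart f K) (n + K)
    rw [h2]
    split_ifs with hn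
    · exact (hf n (by omega)).symm
    · rw [powPart, PowerSeries.coeff_mk]
      congr 1
      omega
  constructor
  · intro h
    ext n
    rw [key, ← h]
    rfl
  · intro h
    ext n
    rw [← key n, ← h]
    rfl

/-- Clearing `x^K` moves an identity of rational functions into power series, where convergence
arguments and coefficient comparison are available. -/
theorem poleDenom_mul_eq_iff (hf : ∀ n < -(K : ℤ), f n = 0) {g : RatFunc ℂ}
    (hg : iotaZero g = f) :
    algebraMap _ (RatFunc ℂ) (poleDenom z k l) * g = algebraMap _ _ p ↔
      (poleDenom z k l : PowerSeries ℂ) * powPart f K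
        = ((Polynomial.X ^ K * p : Polynomial ℂ) : PowerSeries ℂ) := by
  rw [laurent_eq_iff hf] at hg
  rw [← laurent.injective.eq_iff, map_mul, laurent_polynomial, laurent_polynomial, hg,
    ← (HahnSeries.ofPowerSeries_injective (Γ := ℤ) (R := ℂ)).eq_iff, map_mul, Polynomial.coe_mul, map_mul,
    Polynomial.coe_pow, Polynomial.coe_X, map_pow, HahnSeries.ofPowerSeries_X]
  have hs : (HahnSeries.single (1 : ℤ) (1 : ℂ)) ^ K * HahnSeries.single (-K : ℤ) 1 = 1 := by
    rw [HahnSeries.single_pow, HahnSeries.single_mul_single]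
    simp
  have h0 : (HahnSeries.single (1 : ℤ) (1 : ℂ)) ^ K ≠ 0 := left_ne_zero_of_mul_eq_one hs
  rw [← mul_right_inj' h0, mul_left_comm, ← mul_assoc (_ ^ K), hs, one_mul]

theorem exists_ratFunc (hf : ∀ n < -(K : ℤ), f n = 0)
    (h : (poleDenom z k l : PowerSeries ℂ) * powPart f K
      = ((Polynomial.X ^ K * p : Polynomial ℂ) : PowerSeries ℂ)) : ∃ g, iotaZero g = f := by
  have hd : algebraMap (Polynomial ℂ) (RatFunc ℂ) (poleDenom z k l) ≠ 0 := by
    simpa using poleDenom_ne_zero z k l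
  refine ⟨algebraMap _ _ p / algebraMap _ _ (poleDenom z k l), ?_⟩
  rw [laurent_eq_iff hf, map_div₀, div_eq_iff ((map_ne_zero _).2 hd), laurent_polynomial,
    laurent_polynomial, mul_assoc, ← map_mul, mul_comm (powPart f K), h, Polynomial.coe_mul,
    Polynomial.coe_pow, Polynomial.coe_X, map_mul, map_pow, HahnSeries.ofPowerSeries_X,
    ← mul_assoc, HahnSeries.single_pow, HahnSeries.single_mul_single]
  simp

theorem hasSum_iff_powPart (hf : ∀ n < -(K : ℤ), f n = 0) {x : ℂ} (hx : x ≠ 0) (S : ℂ) :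
    HasSum (fun n : ℤ => f n * x ^ n) S ↔
      HasSum (fun n : ℕ => PowerSeries.coeff n (powPart f K) * x ^ n) (x ^ K * S) := by
  have hinj : Function.Injective fun n : ℕ => (n : ℤ) - K := fun a b h => by
    simpa using h
  rw [← hinj.hasSum_iff, ← hasSum_mul_left_iff (pow_ne_zero K hx)]
  · refine iff_of_eq (congrArg (fun F => HasSum F (x ^ K * S)) (funext fun n => ?_))
    simp only [Function.comp_apply, powPart, PowerSeries.coeff_mk]
    rw [zpow_sub₀ hx, zpow_natCast, zpow_natCast]
    field_simp
  · intro n hn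
    rw [hf n, zero_mul]
    by_contra h
    exact hn ⟨(n + K).toNat, by dsimp only; omega⟩

/-- If a Laurent series converges to `p(x) / (x^k (x+z)^l)` then it is the expansion of this
rational function. -/
theorem poleDenom_mul_powPart (hz : z ≠ 0) (hf : ∀ n < -(K : ℤ), f n = 0)
    (h : ∀ x : ℂ, 0 < ‖x‖ → ‖x‖ < ‖z‖ →
      HasSum (fun n : ℤ => f n * x ^ n) (p.eval x / (x ^ k * (x + z) ^ l))) :
    (poleDenom z k l : PowerSeries ℂ) * powPart f K
      = ((Polynomial.X ^ K * p : Polynomial ℂ) : PowerSeries ℂ) := by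
  have hs := fun x h1 h2 => (hasSum_iff_powPart hf (norm_pos_iff.1 h1) _).1 (h x h1 h2)
  have hA : ∀ x : ℂ, 0 < ‖x‖ → ‖x‖ < ‖z‖ → AbsConv (powPart f K) x := fun x h1 h2 =>
    (hs x h1 h2).summable.norm
  -- The difference of the two sides converges absolutely to `0` in the punctured disc, so the
  -- identity theorem applies.
  rw [← sub_eq_zero]
  refine eq_zero_of_evalSum (norm_pos_iff.2 hz)
    (fun x h1 h2 => ((absConv_polynomial _ x).mul (hA x h1 h2)).sub (absConv_polynomial _ x))
    fun x h1 h2 => ?_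
  have hx : x ≠ 0 := norm_pos_iff.1 h1
  have hxz : x + z ≠ 0 := fun h => by
    rw [eq_neg_of_add_eq_zero_left h, norm_neg] at h2
    exact lt_irrefl _ h2
  rw [evalSum_sub ((absConv_polynomial _ x).mul (hA x h1 h2)) (absConv_polynomial _ x),
    evalSum_mul (absConv_polynomial _ x) (hA x h1 h2), evalSum_polynomial, evalSum_polynomial,
    eval_poleDenom, evalSum, (hs x h1 h2).tsum_eq, Polynomial.eval_mul, Polynomial.eval_pow,
    Polynomial.eval_X]
  field_simp
  ring

/-- The Laurent expansion at `0` of `p(x) / (x^k (x+z)^l)` converges to it. -/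
theorem hasSum_of_poleDenom_mul_powPart (hz : z ≠ 0) (hf : ∀ n < -(K : ℤ), f n = 0)
    (h : (poleDenom z K l : PowerSeries ℂ) * powPart f K
      = ((Polynomial.X ^ K * p : Polynomial ℂ) : PowerSeries ℂ)) {x : ℂ} (hx : 0 < ‖x‖)
    (hxz : ‖x‖ < ‖z‖) :
    HasSum (fun n : ℤ => f n * x ^ n) (p.eval x / (x ^ K * (x + z) ^ l)) := by
  rw [poleDenom, Polynomial.coe_mul, Polynomial.coe_mul, mul_assoc] at h
  -- The pole order in the denominator is the same `K` as in `powPart f K`, so `x^K` cancels and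
  -- `(x+z)^l` times the power series is `p` itself.
  have h' := mul_left_cancel₀ (by simp) h
  have hA := absConv_of_mul_eq hz hxz h'
  have hx0 : x ≠ 0 := norm_pos_iff.1 hx
  have hne : x + z ≠ 0 := fun h => by
    rw [eq_neg_of_add_eq_zero_left h, norm_neg] at hxz
    exact lt_irrefl _ hxz
  have e := evalSum_mul (absConv_polynomial ((Polynomial.X + Polynomial.C z) ^ l) x) hA
  rw [h', evalSum_polynomial, evalSum_polynomial] at e
  simp only [Polynomial.eval_pow, Polynomial.eval_add, Polynomial.eval_X, Polynomial.eval_C] at e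
  rw [hasSum_iff_powPart hf hx0, e]
  have hs : HasSum _ (evalSum (powPart f K) x) := hA.of_norm.hasSum
  convert hs using 1
  field_simp

/-- This identifies the first term of `defect` at `p = l` with a coefficient of `(x+z)^l f(x)`, so
that its vanishing makes this product a Laurent polynomial. -/
theorem coeff_X_add_C_pow_mul_powPart (hz : z ≠ 0) (hf : ∀ n < -(K : ℤ), f n = 0) (l n : ℕ) :
    PowerSeries.coeff n ((((Polynomial.X + Polynomial.C z) ^ l : Polynomial ℂ) : PowerSeries ℂ) * powPart f K)
      = binomSum l z 1 (fun m => f (-m - 1)) (K - n - 1) := by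
  have hc : ∀ m, (K : ℤ) ≤ m → f (-m - 1) = 0 := fun m hm => hf _ (by omega)
  induction l generalizing n with
  | zero =>
    rw [pow_zero, Polynomial.coe_one, one_mul, Nat.cast_zero, binomSum_zero_exponent, powPart,
      PowerSeries.coeff_mk]
    congr 1
    ring
  | succ l ih =>
    rw [pow_succ', Polynomial.coe_mul, mul_assoc, Polynomial.coe_add, Polynomial.coe_X,
      Polynomial.coe_C, add_mul, map_add, PowerSeries.coeff_C_mul, ih, Nat.cast_succ,
      binomSum_succ ⟨K, hc⟩ _ hz, one_mul, add_comm]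
    congr 1
    rcases n with _ | n
    · rw [PowerSeries.coeff_zero_X_mul, binomSum_of_tail]
      exact fun m hm => hc m (by omega)
    · rw [PowerSeries.coeff_succ_X_mul, ih]
      congr 1
      push_cast
      ring

/-- If `(x+z)^l f(x)` is a Laurent polynomial with exponents between `-K` and `D - K` then
`x^K (x+z)^l f(x)` is a polynomial of degree at most `D`. -/
theorem exists_polynomial (hz : z ≠ 0) (hf : ∀ n < -(K : ℤ), f n = 0) {D : ℕ}
    (h : ∀ s : ℤ, s + D < K - 1 → binomSum l z 1 (fun m => f (-m - 1)) s = 0) :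
    ∃ p : Polynomial ℂ, p.natDegree ≤ D ∧ (poleDenom z K l : PowerSeries ℂ) * powPart f K
      = ((Polynomial.X ^ K * p : Polynomial ℂ) : PowerSeries ℂ) := by
  -- Truncation loses nothing: a coefficient of degree `n > D` is the binomial sum at `s = K - n -
  -- 1`, which vanishes by hypothesis.
  refine ⟨PowerSeries.trunc (D + 1)
    ((((Polynomial.X + Polynomial.C z) ^ l : Polynomial ℂ) : PowerSeries ℂ) * powPart f K),
    Nat.lt_succ_iff.1 (PowerSeries.natDegree_trunc_lt _ D), ?_⟩
  rw [poleDenom, Polynomial.coe_mul, Polynomial.coe_mul, mul_assoc]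
  congr 1
  ext n
  rw [Polynomial.coeff_coe, PowerSeries.coeff_trunc]
  split_ifs with hn
  · rfl
  · rw [coeff_X_add_C_pow_mul_powPart hz hf]
    exact h _ (by omega)

/-- The residue theorem for a Laurent series `f` with `x^k (x+z)^l f(x)` polynomial. -/
theorem residueIdentity_of_poleDenom (hz : z ≠ 0) {g : RatFunc ℂ}
    (h : algebraMap _ (RatFunc ℂ) (poleDenom z k l) * g = algebraMap _ _ p) :
    ResidueIdentity z g := by
  refine residueIdentity_of_mul_eq (k := k) (l := l) (q := p) hz ?_
  rw [← h, poleDenom]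
  simp [mul_assoc]

end

/-! ### Opposite vertex operators -/

section Opposite

variable {V : Type*} [AddCommGroup V] [Module ℂ V] (𝒱 : VOA V)

/-- The projection onto `V_(k)` as a linear map. -/
def VOA.projₗ (k : ℤ) : V →ₗ[ℂ] V :=
  Submodule.subtype _ ∘ₗ DirectSum.component ℂ ℤ _ k ∘ₗ
    (LinearEquiv.ofBijective (DirectSum.coeLinearMap _) 𝒱.grading).symm.toLinearMap

theorem VOA.proj_of_mem {m : ℤ} {v : V}
    (hv : v ∈ Module.End.eigenspace (𝒱.L 0) (m : ℂ)) (k : ℤ) :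
    𝒱.proj k v = if k = m then v else 0 := by
  have e : (LinearEquiv.ofBijective (DirectSum.coeLinearMap _) 𝒱.grading).symm v
      = DirectSum.lof ℂ ℤ (fun n : ℤ => Module.End.eigenspace (𝒱.L 0) (n : ℂ)) m ⟨v, hv⟩ :=
    (LinearEquiv.symm_apply_eq _).2 (DirectSum.coeLinearMap_lof
      (fun n : ℤ => Module.End.eigenspace (𝒱.L 0) (n : ℂ)) m ⟨v, hv⟩).symm
  rw [VOA.proj, e]
  split_ifs with h
  · subst h
    rw [DirectSum.lof_apply]
  · rw [DirectSum.lof_eq_of, DirectSum.of_eq_of_ne _ _ _ h]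
    rfl

theorem VOA.finite_proj (v : V) : {k : ℤ | 𝒱.proj k v ≠ 0}.Finite := by
  refine Set.Finite.subset (DFinsupp.finite_support
    ((LinearEquiv.ofBijective (DirectSum.coeLinearMap _) 𝒱.grading).symm v)) fun k hk => ?_
  simp only [Set.mem_ofPred_eq] at hk ⊢
  exact fun h => hk (by rw [VOA.proj, h]; rfl)

theorem VOA.homogeneous_induction {p : V → Prop} (v : V)
    (mem : ∀ (m : ℤ) (v : V), v ∈ Module.End.eigenspace (𝒱.L 0) (m : ℂ) → p v) (zero : p 0)
    (add : ∀ u v, p u → p v → p (u + v)) : p v :=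
  Submodule.iSup_induction _ (motive := p) (𝒱.grading.submodule_iSup_eq_top ▸ Submodule.mem_top) mem zero add

/-- `L(1)` lowers weights by one, and the weights of `V` are bounded below. -/
theorem VOA.L1_pow_eq_zero {m : ℤ} {v : V}
    (hv : v ∈ Module.End.eigenspace (𝒱.L 0) (m : ℂ)) : ∃ J : ℕ, ∀ j, J ≤ j →
      (𝒱.L 1 ^ j) v = 0 := by
  obtain ⟨N, hN⟩ := 𝒱.bounded_below
  refine ⟨(m - N + 1).toNat, fun j hj => ?_⟩
  have h := 𝒱.L1_pow_mem hv j
  have h2 := hN (m - j) (by omega)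
  push_cast at h2
  rwa [h2, Submodule.mem_bot] at h

theorem VOA.exists_bounds (v : V) : ∃ (K : Finset ℤ) (J : ℕ),
    (∀ k, k ∉ K → 𝒱.proj k v = 0) ∧ ∀ k j, J ≤ j → (𝒱.L 1 ^ j) (𝒱.proj k v) = 0 := by
  choose J hJ using fun k => 𝒱.L1_pow_eq_zero (𝒱.proj_mem k v)
  refine ⟨(𝒱.finite_proj v).toFinset, (𝒱.finite_proj v).toFinset.sup J,
    fun k hk => by simpa using hk, fun k j hj => ?_⟩
  by_cases hk : 𝒱.proj k v = 0
  · rw [hk, map_zero]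
  · exact hJ k j ((Finset.le_sup (f := J) (by simpa using hk)).trans hj)

variable {E E' : Type*} [AddCommGroup E] [Module ℂ E] [AddCommGroup E'] [Module ℂ E']

/-- Only `G 0 = 0` is required, not linearity: `YLo` is not known to be linear in `v` for a
functional outside `𝒟_{Q(z)}`. -/
theorem VOA.opp_eq_sum {G : V → ℤ → E} (hG : ∀ n, G 0 n = 0) {v : V} {K : Finset ℤ} {J : ℕ}
    (hK : ∀ k, k ∉ K → 𝒱.proj k v = 0)
    (hJ : ∀ k j, J ≤ j → (𝒱.L 1 ^ j) (𝒱.proj k v) = 0) (n : ℤ) :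
    𝒱.opp G v n = ∑ k ∈ K, ∑ j ∈ Finset.range J, ((-1 : ℂ) ^ k / (j.factorial : ℂ)) •
      G ((𝒱.L 1 ^ j) (𝒱.proj k v)) (2 * k - n - j - 2) := by
  rw [VOA.opp, finsum_eq_sum_of_support_subset (s := K)]
  · refine Finset.sum_congr rfl fun k _ => finsum_eq_sum_of_support_subset _ fun j hj => ?_
    rw [Function.mem_support] at hj
    by_contra h
    exact hj (by rw [hJ k j (by simpa using h), hG, smul_zero])
  · intro k hk
    rw [Function.mem_support] at hk
    by_contra h
    refine hk ((finsum_congr fun j => ?_).trans finsum_zero)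
    rw [hK k h, map_zero, hG, smul_zero]

theorem VOA.opp_of_mem {G : V → ℤ → E} (hG : ∀ n, G 0 n = 0) {m : ℤ} {v : V}
    (hv : v ∈ Module.End.eigenspace (𝒱.L 0) (m : ℂ)) {J : ℕ}
    (hJ : ∀ j, J ≤ j → (𝒱.L 1 ^ j) v = 0) (n : ℤ) :
    𝒱.opp G v n = ∑ j ∈ Finset.range J, ((-1 : ℂ) ^ m / (j.factorial : ℂ)) •
      G ((𝒱.L 1 ^ j) v) (2 * m - n - j - 2) := by
  rw [𝒱.opp_eq_sum hG (K := {m}) (J := J), Finset.sum_singleton, 𝒱.proj_of_mem hv, if_pos rfl]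
  · intro k hk
    rw [𝒱.proj_of_mem hv, if_neg (by simpa using hk)]
  · intro k j hj
    rw [𝒱.proj_of_mem hv]
    split_ifs
    · exact hJ j hj
    · exact map_zero _

theorem VOA.opp_zero {G : V → ℤ → E} (hG : ∀ n, G 0 n = 0) (n : ℤ) : 𝒱.opp G 0 n = 0 := by
  rw [𝒱.opp_of_mem hG (m := 0) (v := 0) (Submodule.zero_mem _) (J := 0) fun _ _ => map_zero _,
    Finset.sum_range_zero]

theorem VOA.opp_add (G : V →ₗ[ℂ] ℤ → E) (u v : V) (n : ℤ) :
    𝒱.opp G (u + v) n = 𝒱.opp G u n + 𝒱.opp G v n := by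
  have hG : ∀ n, G 0 n = 0 := fun n => by rw [map_zero]; rfl
  obtain ⟨K₁, J₁, hK₁, hJ₁⟩ := 𝒱.exists_bounds u
  obtain ⟨K₂, J₂, hK₂, hJ₂⟩ := 𝒱.exists_bounds v
  have hp : ∀ k, 𝒱.proj k (u + v) = 𝒱.proj k u + 𝒱.proj k v := fun k => map_add (𝒱.projₗ k) u v
  have h1 : ∀ k, k ∉ K₁ ∪ K₂ → 𝒱.proj k u = 0 := fun k hk =>
    hK₁ k fun h => hk (Finset.mem_union_left _ h)
  have h2 : ∀ k, k ∉ K₁ ∪ K₂ → 𝒱.proj k v = 0 := fun k hk =>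
    hK₂ k fun h => hk (Finset.mem_union_right _ h)
  have h3 : ∀ k j, max J₁ J₂ ≤ j → (𝒱.L 1 ^ j) (𝒱.proj k u) = 0 := fun k j hj =>
    hJ₁ k j ((le_max_left _ _).trans hj)
  have h4 : ∀ k j, max J₁ J₂ ≤ j → (𝒱.L 1 ^ j) (𝒱.proj k v) = 0 := fun k j hj =>
    hJ₂ k j ((le_max_right _ _).trans hj)
  rw [𝒱.opp_eq_sum hG h1 h3, 𝒱.opp_eq_sum hG h2 h4,
    𝒱.opp_eq_sum hG (v := u + v) (K := K₁ ∪ K₂) (J := max J₁ J₂)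
      (fun k hk => by rw [hp, h1 k hk, h2 k hk, add_zero])
      (fun k j hj => by rw [hp, map_add, h3 k j hj, h4 k j hj, add_zero]),
    ← Finset.sum_add_distrib]
  refine Finset.sum_congr rfl fun k _ => ?_
  rw [← Finset.sum_add_distrib]
  refine Finset.sum_congr rfl fun j _ => ?_
  rw [hp, map_add, map_add, Pi.add_apply, smul_add]

theorem VOA.opp_smul (G : V →ₗ[ℂ] ℤ → E) (c : ℂ) (v : V) (n : ℤ) :
    𝒱.opp G (c • v) n = c • 𝒱.opp G v n := by
  have hG : ∀ n, G 0 n = 0 := fun n => by rw [map_zero]; rfl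
  obtain ⟨K, J, hK, hJ⟩ := 𝒱.exists_bounds v
  have hp : ∀ k, 𝒱.proj k (c • v) = c • 𝒱.proj k v := fun k => map_smul (𝒱.projₗ k) c v
  rw [𝒱.opp_eq_sum hG hK hJ, 𝒱.opp_eq_sum hG (v := c • v) (K := K) (J := J)
      (fun k hk => by rw [hp, hK k hk, smul_zero])
      (fun k j hj => by rw [hp, map_smul, hJ k j hj, smul_zero]), Finset.smul_sum]
  refine Finset.sum_congr rfl fun k _ => ?_
  rw [Finset.smul_sum]
  refine Finset.sum_congr rfl fun j _ => ?_
  rw [hp, map_smul, map_smul, Pi.smul_apply, smul_comm]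

/-- `G ↦ G^o` for linear maps `G`. -/
def VOA.oppₗ (G : V →ₗ[ℂ] ℤ → E) : V →ₗ[ℂ] ℤ → E where
  toFun := 𝒱.opp G
  map_add' u v := funext (𝒱.opp_add G u v)
  map_smul' c v := funext (𝒱.opp_smul G c v)

theorem VOA.map_opp (T : E →ₗ[ℂ] E') {G : V → ℤ → E} (hG : ∀ n, G 0 n = 0) (v : V) (n : ℤ) :
    T (𝒱.opp G v n) = 𝒱.opp (fun v n => T (G v n)) v n := by
  obtain ⟨K, J, hK, hJ⟩ := 𝒱.exists_bounds v
  rw [𝒱.opp_eq_sum hG hK hJ, 𝒱.opp_eq_sum (fun n => by rw [hG, map_zero]) hK hJ]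
  simp only [map_sum, map_smul]

/-- This is `(1 - 1)^s / s!`, the coefficient form of `e^{-x} e^x = 1`. -/
theorem sum_antidiagonal_neg_one_pow_div_factorial (s : ℕ) :
    ∑ j ∈ Finset.range (s + 1), (-1 : ℂ) ^ j / ((j.factorial : ℂ) * ((s - j).factorial : ℂ))
      = if s = 0 then 1 else 0 := by
  have h := Int.alternating_sum_range_choose (n := s)
  have h' : ∑ j ∈ Finset.range (s + 1), (-1 : ℂ) ^ j * (s.choose j : ℂ)
      = if s = 0 then 1 else 0 := by
    exact_mod_cast congrArg (Int.cast : ℤ → ℂ) h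
  have e : ∀ j ∈ Finset.range (s + 1),
      (-1 : ℂ) ^ j / ((j.factorial : ℂ) * ((s - j).factorial : ℂ))
        = ((-1 : ℂ) ^ j * (s.choose j : ℂ)) / s.factorial := fun j hj => by
    rw [Nat.cast_choose ℂ (Finset.mem_range_succ_iff.1 hj)]
    have := Nat.factorial_ne_zero s
    field_simp
  rw [Finset.sum_congr rfl e, ← Finset.sum_div, h']
  split_ifs with hs
  · simp [hs]
  · simp

/-- `(G^o)^o = G`. -/
theorem VOA.opp_opp (G : V →ₗ[ℂ] ℤ → E) (v : V) (n : ℤ) : 𝒱.opp (𝒱.opp G) v n = G v n := by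
  have hG : ∀ n, G 0 n = 0 := fun n => by rw [map_zero]; rfl
  induction v using 𝒱.homogeneous_induction with
  | zero => rw [𝒱.opp_zero (𝒱.opp_zero hG), hG]
  | add u v hu hv =>
    refine (𝒱.opp_add (𝒱.oppₗ G) u v n).trans ?_
    rw [map_add, Pi.add_apply, ← hu, ← hv]
    rfl
  | mem m v hv =>
    obtain ⟨J, hJ⟩ := 𝒱.L1_pow_eq_zero hv
    rw [𝒱.opp_of_mem (𝒱.opp_zero hG) hv hJ]
    -- `L(1)^j v` has weight `m - j`, so the signs combine to `(-1)^{2m-j} = (-1)^j` and the mode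
    -- index becomes `n - j - i`. Grouping by `s = j + i` then leaves only `s = 0`.
    have inner : ∀ j ∈ Finset.range J, ((-1 : ℂ) ^ m / (j.factorial : ℂ)) •
        𝒱.opp G ((𝒱.L 1 ^ j) v) (2 * m - n - j - 2)
        = ∑ i ∈ Finset.range (J - j), ((-1 : ℂ) ^ j / ((j.factorial : ℂ) * (i.factorial : ℂ))) •
          G ((𝒱.L 1 ^ (j + i)) v) (n - (j + i : ℕ)) := by
      intro j _
      have hm : (𝒱.L 1 ^ j) v ∈ Module.End.eigenspace (𝒱.L 0) ((m - j : ℤ) : ℂ) := by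
        have := 𝒱.L1_pow_mem hv j
        push_cast
        exact this
      rw [𝒱.opp_of_mem hG hm (J := J - j) fun i hi => by
        rw [← Module.End.mul_apply, ← pow_add]
        exact hJ _ (by omega), Finset.smul_sum]
      refine Finset.sum_congr rfl fun i _ => ?_
      rw [smul_smul, ← Module.End.mul_apply, ← pow_add, add_comm i j]
      congr 1
      · rw [div_mul_div_comm, ← zpow_add₀ (by norm_num), show m + (m - j) = 2 * m - j by ring,
          zpow_sub₀ (by norm_num), zpow_mul, zpow_natCast]
        congr 1
        rcases neg_one_pow_eq_or ℂ j with h | h <;> rw [h] <;> norm_num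
      · exact congrArg _ (by push_cast; ring)
    rw [Finset.sum_congr rfl inner, ← Finset.sum_range_diag_flip J fun j i =>
      ((-1 : ℂ) ^ j / ((j.factorial : ℂ) * (i.factorial : ℂ))) •
          G ((𝒱.L 1 ^ (j + i)) v) (n - (j + i : ℕ))]
    have step : ∀ s ∈ Finset.range J, ∑ j ∈ Finset.range (s + 1),
        ((-1 : ℂ) ^ j / ((j.factorial : ℂ) * ((s - j).factorial : ℂ))) •
          G ((𝒱.L 1 ^ (j + (s - j))) v) (n - (j + (s - j) : ℕ))
        = (if s = 0 then 1 else 0 : ℂ) • G ((𝒱.L 1 ^ s) v) (n - s) := by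
      intro s _
      rw [← sum_antidiagonal_neg_one_pow_div_factorial, Finset.sum_smul]
      refine Finset.sum_congr rfl fun j hj => ?_
      rw [Nat.add_sub_cancel' (Finset.mem_range_succ_iff.1 hj)]
    rw [Finset.sum_congr rfl step]
    rcases J with _ | J
    · rw [Finset.sum_range_zero, show v = 0 from hJ 0 le_rfl, hG]
    · rw [Finset.sum_range_succ', Finset.sum_eq_zero fun s _ => by rw [if_neg s.succ_ne_zero,
        zero_smul]]
      simp

theorem VOA.opp_tail (G : V →ₗ[ℂ] ℤ → E) (hG : ∀ v, ∃ N : ℤ, ∀ n, N ≤ n → G v n = 0) (v : V) :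
    ∃ N : ℤ, ∀ n ≤ N, 𝒱.opp G v n = 0 := by
  have hG0 : ∀ n, G 0 n = 0 := fun n => by rw [map_zero]; rfl
  induction v using 𝒱.homogeneous_induction with
  | zero => exact ⟨0, fun n _ => 𝒱.opp_zero hG0 n⟩
  | add u v hu hv =>
    obtain ⟨N₁, h₁⟩ := hu
    obtain ⟨N₂, h₂⟩ := hv
    exact ⟨min N₁ N₂, fun n hn => by rw [𝒱.opp_add, h₁ n (by omega), h₂ n (by omega), add_zero]⟩
  | mem m v hv =>
    obtain ⟨J, hJ⟩ := 𝒱.L1_pow_eq_zero hv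
    choose N hN using fun j => hG ((𝒱.L 1 ^ j) v)
    obtain ⟨B, hB⟩ := ((Finset.range J).image N).bddAbove
    refine ⟨2 * m - J - 2 - B, fun n hn => ?_⟩
    rw [𝒱.opp_of_mem hG0 hv hJ]
    refine Finset.sum_eq_zero fun j hj => ?_
    have h1 : N j ≤ B := hB (Finset.mem_coe.2 (Finset.mem_image_of_mem N hj))
    have h2 := Finset.mem_range.1 hj
    rw [hN j _ (by omega), smul_zero]

theorem VOA.L0_vac : 𝒱.vac ∈ Module.End.eigenspace (𝒱.L 0) ((0 : ℤ) : ℂ) := by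
  rw [Module.End.mem_eigenspace_iff, VOAData.L, 𝒱.creation _ _ (by norm_num)]
  simp

theorem VOA.opp_vac {G : V → ℤ → E} (hG : ∀ n, G 0 n = 0) (n : ℤ) :
    𝒱.opp G 𝒱.vac n = G 𝒱.vac (-n - 2) := by
  rw [𝒱.opp_of_mem hG 𝒱.L0_vac (J := 1) fun j hj => ?_, Finset.sum_range_one]
  · simp
  · obtain ⟨i, rfl⟩ := Nat.exists_eq_add_of_le' hj
    rw [pow_succ, Module.End.mul_apply, VOAData.L, 𝒱.creation _ _ (by norm_num), map_zero]

end Opposite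

/-! ### Contragredient modules -/

section Contragredient

variable {V : Type*} [AddCommGroup V] [Module ℂ V] {M : Type*} [AddCommGroup M] [Module ℂ M]

/-- `v ↦ (v_n)_n` as a linear map. -/
def modeₗ (Y : V →ₗ[ℂ] VertexOperator ℂ M) : V →ₗ[ℂ] ℤ → Module.End ℂ M :=
  VertexOperator.ncoeff ∘ₗ Y

theorem modeₗ_apply (Y : V →ₗ[ℂ] VertexOperator ℂ M) (v : V) (n : ℤ) :
    modeₗ Y v n = mode Y v n := rfl

theorem mode_tail (Y : V →ₗ[ℂ] VertexOperator ℂ M) (v : V) (w : M) :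
    ∃ N : ℤ, ∀ n, N ≤ n → mode Y v n w = 0 := by
  obtain ⟨N, hN⟩ := lcoeff_bdd (Y v) w
  exact ⟨-N, fun n hn => hN (-n - 1) (by omega)⟩

variable {W : Type*} [AddCommGroup W] [Module ℂ W] (𝒱 : VOA V)

theorem contragredient_apply (P : WeakModule 𝒱.toVOAData W) (v : V) (n : ℤ)
    (f : P.restrictedDual) (w : W) :
    (contragredient 𝒱 P v n f : Module.Dual ℂ W) w = (f : Module.Dual ℂ W)
      (𝒱.opp (modeₗ P.Y) v n w) := rfl

theorem contragredient_add (P : WeakModule 𝒱.toVOAData W) (u v : V) (n : ℤ) :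
    contragredient 𝒱 P (u + v) n = contragredient 𝒱 P u n + contragredient 𝒱 P v n := by
  refine LinearMap.ext fun f => Subtype.ext (LinearMap.ext fun w => ?_)
  simp only [contragredient_apply, 𝒱.opp_add, LinearMap.add_apply, map_add, Submodule.coe_add]

theorem contragredient_smul (P : WeakModule 𝒱.toVOAData W) (c : ℂ) (v : V) (n : ℤ) :
    contragredient 𝒱 P (c • v) n = c • contragredient 𝒱 P v n := by
  refine LinearMap.ext fun f => Subtype.ext (LinearMap.ext fun w => ?_)
  simp only [contragredient_apply, 𝒱.opp_smul, LinearMap.smul_apply, map_smul,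
    Submodule.coe_smul]

theorem contragredient_vac (P : WeakModule 𝒱.toVOAData W) (n : ℤ) :
    contragredient 𝒱 P 𝒱.vac n = if n = -1 then 1 else 0 := by
  refine LinearMap.ext fun f => Subtype.ext (LinearMap.ext fun w => ?_)
  rw [contragredient_apply, 𝒱.opp_vac (fun n => by rw [map_zero]; rfl), modeₗ_apply, P.vacuum]
  by_cases h : n = -1
  · rw [if_pos h, if_pos (by omega)]
    rfl
  · rw [if_neg h, if_neg (by omega)]
    simp

/-- In the `j`-th summand both the weight of `L(1)^j v` and the mode index drop by `j`, so all
summands shift the weight equally. -/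
theorem opp_mode_weight (P : WeakModule 𝒱.toVOAData W) {m : ℤ} {v : V}
    (hv : v ∈ Module.End.eigenspace (𝒱.L 0) (m : ℂ)) (n : ℤ) {h : ℂ} {w : W}
    (hw : w ∈ P.weightSpace h) :
    𝒱.opp (modeₗ P.Y) v n w ∈ P.weightSpace (h + (n + 1 - m)) := by
  obtain ⟨J, hJ⟩ := 𝒱.L1_pow_eq_zero hv
  rw [𝒱.opp_of_mem (fun n => by rw [map_zero]; rfl) hv hJ, LinearMap.sum_apply]
  refine Submodule.sum_mem _ fun j _ => ?_
  rw [LinearMap.smul_apply]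
  refine Submodule.smul_mem _ _ ?_
  have := mode_weight P (𝒱.L1_pow_mem hv j) (2 * m - n - j - 2) hw
  rwa [show h + ((m : ℂ) - j - ((2 * m - n - j - 2 : ℤ) : ℂ) - 1) = h + (n + 1 - m) by
    push_cast; ring] at this

/-- The truncation condition for the contragredient module. -/
theorem contragredient_tail (P : OrdModule 𝒱.toVOAData W) (v : V)
    (f : P.toWeakModule.restrictedDual) :
    ∃ N : ℤ, ∀ n, N ≤ n → contragredient 𝒱 P.toWeakModule v n f = 0 := by
  induction v using 𝒱.homogeneous_induction with
  | zero =>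
    refine ⟨0, fun n _ => ?_⟩
    have := contragredient_smul 𝒱 P.toWeakModule 0 0 n
    rw [zero_smul, zero_smul] at this
    rw [this, LinearMap.zero_apply]
  | add u v hu hv =>
    obtain ⟨N₁, h₁⟩ := hu
    obtain ⟨N₂, h₂⟩ := hv
    exact ⟨max N₁ N₂, fun n hn => by
      rw [contragredient_add, LinearMap.add_apply, h₁ n (by omega), h₂ n (by omega), add_zero]⟩
  | mem m v hv =>
    have hf : {h : ℂ | ∃ w ∈ P.weightSpace h, (f : Module.Dual ℂ W) w ≠ 0}.Finite := f.2
    choose N hN using P.bounded_below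
    obtain ⟨B, hB⟩ := (hf.image N).bddBelow
    -- A nonzero value on `W_(h)` forces `h + n + 1 - m` into the finite set of weights seen by `f`.
    -- From such a weight `h` lies `n + 1 - m > -B` steps below, past the common bound `B`, so
    -- `W_(h) = 0`.
    refine ⟨m - B, fun n hn => Subtype.ext (LinearMap.ext fun w => ?_)⟩
    rw [contragredient_apply]
    have hw : w ∈ ⨆ h : ℂ, P.weightSpace h := P.grading ▸ Submodule.mem_top
    induction hw using Submodule.iSup_induction' with
    | zero => simp
    | add x y _ _ hx hy =>
      rw [map_add, map_add, hx, hy]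
      simp
    | mem h w hw =>
      by_contra hne
      have hmem := opp_mode_weight 𝒱 P.toWeakModule hv n hw
      have h1 : B ≤ N (h + (n + 1 - m)) := hB ⟨_, ⟨_, hmem, hne⟩, rfl⟩
      have h2 := hN (h + (n + 1 - m)) (m - 1 - n) (by omega)
      rw [show h + (n + 1 - m) + ((m - 1 - n : ℤ) : ℂ) = h by push_cast; ring] at h2
      rw [h2, Submodule.mem_bot] at hw
      rw [hw, map_zero, map_zero] at hne
      exact hne rfl

end Contragredient

/-! ### Modules for the tensor product -/

theorem finsum_int {E : Type*} [AddCommMonoid E] {g : ℤ → E} (hg : g.support.Finite) :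
    ∑ᶠ i : ℤ, g i = (∑ᶠ i : ℕ, g (-1 - i)) + ∑ᶠ i : ℕ, g i := by
  have h1 : Function.Injective fun i : ℕ => (-1 - i : ℤ) := fun a b h => by simpa using h
  have h2 : Function.Injective fun i : ℕ => (i : ℤ) := fun a b h => by simpa using h
  have hu : Set.range (fun i : ℕ => (-1 - i : ℤ)) ∪ Set.range (fun i : ℕ => (i : ℤ))
      = Set.univ := by
    refine Set.eq_univ_of_forall fun i => ?_
    rcases lt_or_ge i 0 with h | h
    · exact Or.inl ⟨(-1 - i).toNat, by dsimp only; omega⟩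
    · exact Or.inr ⟨i.toNat, by dsimp only; omega⟩
  have hd : Disjoint (Set.range fun i : ℕ => (-1 - i : ℤ)) (Set.range fun i : ℕ => (i : ℤ)) := by
    rw [Set.disjoint_left]
    rintro _ ⟨a, rfl⟩ ⟨b, hb⟩
    dsimp only at hb
    omega
  rw [← finsum_mem_range (f := g) h1, ← finsum_mem_range (f := g) h2, ← finsum_mem_union' hd
    (hg.subset Set.inter_subset_right) (hg.subset Set.inter_subset_right), hu, finsum_mem_univ]

theorem finsum_choose_zero {E : Type*} [AddCommGroup E] [Module ℂ E] (f : ℕ → E) :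
    ∑ᶠ i : ℕ, ((Ring.choose (0 : ℤ) i : ℤ) : ℂ) • f i = f 0 := by
  rw [finsum_eq_single _ 0 fun i hi => ?_]
  · simp
  · obtain ⟨j, rfl⟩ := Nat.exists_eq_succ_of_ne_zero hi
    rw [Ring.choose_zero_succ]
    simp

theorem finsum_neg_one_pow_mul_choose_zero {E : Type*} [AddCommGroup E] [Module ℂ E] (f : ℕ → E) :
    ∑ᶠ i : ℕ, ((-1 : ℂ) ^ i * (Ring.choose (0 : ℤ) i : ℤ)) • f i = f 0 := by
  rw [finsum_eq_single _ 0 fun i hi => ?_]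
  · simp
  · obtain ⟨j, rfl⟩ := Nat.exists_eq_succ_of_ne_zero hi
    rw [Ring.choose_zero_succ]
    simp

theorem choose_neg_one (i : ℕ) : Ring.choose (-1 : ℤ) i = (-1) ^ i := by
  rw [Ring.choose_neg, show (1 : ℤ) + i - 1 = i by ring, Ring.choose_natCast, Nat.choose_self]
  simp [Units.smul_def, Int.coe_negOnePow_natCast]

section

variable {V : Type*} [AddCommGroup V] [Module ℂ V] (𝒱 : VOA V)

theorem lcoeff_eq_mode {M : Type*} [AddCommGroup M] [Module ℂ M]
    (Y : V →ₗ[ℂ] VertexOperator ℂ M) (v : V) (n : ℤ) : lcoeff (Y v) n = mode Y v (-n - 1) :=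
  VertexOperator.coeff_eq_ncoeff _ _

theorem mode_tensor_vac (u v : V) (i : ℤ) :
    mode (𝒱.tensor 𝒱.toVOAData).Y (u ⊗ₜ[ℂ] 𝒱.vac) i (𝒱.vac ⊗ₜ[ℂ] v)
      = mode 𝒱.Y u i 𝒱.vac ⊗ₜ[ℂ] v := by
  have h : mode (𝒱.tensor 𝒱.toVOAData).Y (u ⊗ₜ[ℂ] 𝒱.vac) i
      = tensorCoeff (𝒱.Y u) (𝒱.Y 𝒱.vac) (-i - 1) := rfl
  rw [h, tensorCoeff_tmul, finsum_eq_single _ (-i - 1) fun j hj => ?_]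
  · rw [lcoeff_eq_mode, lcoeff_eq_mode, 𝒱.vacuum, if_pos (by ring)]
    rw [show -(-i - 1) - 1 = i by ring]
    rfl
  · rw [lcoeff_eq_mode, lcoeff_eq_mode, 𝒱.vacuum, if_neg (by omega), LinearMap.zero_apply,
      TensorProduct.tmul_zero]

variable {A : Type*} [AddCommGroup A] [Module ℂ A]
  (N : WeakModule (𝒱.toVOAData.tensor 𝒱.toVOAData) A)

/-- The commutator formula involves only the vectors `u_i 𝟏 ⊗ v` with `i ≥ 0`, which vanish by the
creation property. -/
theorem Y₁_Y₂_comm (u v : V) (p q : ℤ) (a : A) :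
    Y₁ 𝒱 N u p (Y₂ 𝒱 N v q a) = Y₂ 𝒱 N v q (Y₁ 𝒱 N u p a) := by
  have h := N.jacobi (u ⊗ₜ[ℂ] 𝒱.vac) (𝒱.vac ⊗ₜ[ℂ] v) a p q 0
  rw [finsum_neg_one_pow_mul_choose_zero, finsum_neg_one_pow_mul_choose_zero,
    finsum_eq_zero_of_forall_eq_zero fun i => ?_] at h
  · simp only [Nat.cast_zero, add_zero, sub_zero, zpow_zero, one_smul] at h
    exact sub_eq_zero.1 h
  · rw [mode_tensor_vac, 𝒱.creation _ _ (by omega), TensorProduct.zero_tmul]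
    simp [mode]

/-- Truncation of `Y₂` on `a` bounds `i` below; commuting the factors lets truncation of `Y₁` on `a`
bound it above. -/
theorem finite_support_Y₁_Y₂ (u v : V) (n : ℤ) (a : A) :
    (fun i : ℤ => Y₁ 𝒱 N u i (Y₂ 𝒱 N v (n - 1 - i) a)).support.Finite := by
  obtain ⟨B₁, h₁⟩ := mode_tail N.Y (u ⊗ₜ[ℂ] 𝒱.vac) a
  obtain ⟨B₂, h₂⟩ := mode_tail N.Y (𝒱.vac ⊗ₜ[ℂ] v) a
  refine (Set.finite_Icc (n - 1 - B₂) B₁).subset fun i hi => ?_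
  rw [Function.mem_support] at hi
  constructor
  · by_contra h
    exact hi (by rw [Y₂, h₂ _ (by omega), map_zero])
  · by_contra h
    exact hi (by rw [Y₁_Y₂_comm, Y₁, h₁ _ (by omega), map_zero])

/-- `Y_A(u ⊗ v, x) = Y₁(u,x) Y₂(v,x)`. -/
theorem mode_tmul (u v : V) (n : ℤ) (a : A) :
    mode N.Y (u ⊗ₜ[ℂ] v) n a = ∑ᶠ i : ℤ, Y₁ 𝒱 N u i (Y₂ 𝒱 N v (n - 1 - i) a) := by
  -- Since `u ⊗ v = (u ⊗ 𝟏)_{-1}(𝟏 ⊗ v)`, this case expresses `Y_A(u ⊗ v,x)` as a normally ordered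
  -- product. Its two halves merge into the ordinary product because the factors commute.
  have h := N.jacobi (u ⊗ₜ[ℂ] 𝒱.vac) (𝒱.vac ⊗ₜ[ℂ] v) a 0 n (-1)
  have hc : ∀ i : ℕ, ((-1 : ℂ) ^ i * ((Ring.choose (-1 : ℤ) i : ℤ) : ℂ)) = 1 := fun i => by
    rw [choose_neg_one]
    push_cast
    rw [← mul_pow]
    norm_num
  rw [finsum_choose_zero, mode_tensor_vac, Nat.cast_zero, add_zero, 𝒱.creation_lim] at h
  simp only [hc, one_smul, zero_add, sub_zero] at h
  rw [finsum_int (finite_support_Y₁_Y₂ 𝒱 N u v n a), ← h, zpow_neg_one, inv_neg_one, neg_one_smul,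
    sub_neg_eq_add]
  congr 1 <;> refine finsum_congr fun i => ?_
  · rw [show n - 1 - (-1 - (i : ℤ)) = n + i by ring]
    rfl
  · rw [Y₁_Y₂_comm]
    rfl

end

/-! ### The operators `Y^L_{Q(z)}` and `Y^R_{Q(z)}` -/

section QLinear

variable {V M : Type*} [AddCommGroup M] [Module ℂ M]
  {Y : V → ℤ → Module.End ℂ M} {z : ℂ} {α : Module.Dual ℂ M} {v : V}

theorem matSeries_apply (w : M) (n : ℤ) : matSeries Y α v w n = α (Y v (-n - 1) w) := rfl

theorem iotaZero_ratFun (h : ∀ w, matSeries Y α v w ∈ LinearMap.range iotaZero) (w : M) :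
    iotaZero (ratFun Y α v w) = matSeries Y α v w := by
  rw [ratFun, dif_pos h]
  exact congrArg Subtype.val ((LinearEquiv.ofInjective iotaZero iotaZero_injective).apply_symm_apply
    ⟨matSeries Y α v w, h w⟩)

theorem ratFun_eq {g : M → RatFunc ℂ} (h : ∀ w, iotaZero (g w) = matSeries Y α v w) (w : M) :
    ratFun Y α v w = g w :=
  iotaZero_injective ((iotaZero_ratFun (fun w => ⟨g w, h w⟩) w).trans (h w).symm)

theorem YLo_apply (n : ℤ) (w : M) :
    YLo Y z α v n w = iotaInf (shiftX z (ratFun Y α v w)) (-n - 1) := rfl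

theorem YR_apply (n : ℤ) (w : M) :
    YR Y z v n α w = iotaZero (shiftX z (ratFun Y α v w)) (-n - 1) := rfl

theorem YLo_of_matSeries_eq_zero (h : ∀ w, matSeries Y α v w = 0) (n : ℤ) :
    YLo Y z α v n = 0 := by
  ext w
  rw [YLo_apply, ratFun_eq (g := fun _ => 0) fun w => by rw [map_zero, h], map_zero, map_zero]
  rfl

theorem modeZero_ratFun (h : ∀ w, matSeries Y α v w ∈ LinearMap.range iotaZero) (w : M) :
    modeZero (ratFun Y α v w) = fun n => α (Y v n w) := by
  ext n
  rw [modeZero, iotaZero_ratFun h, matSeries_apply]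
  congr 3
  ring

theorem modeInf_ratFun (w : M) :
    modeInf z (ratFun Y α v w) = fun n => YLo Y z α v (-n) w := by
  ext n
  rw [YLo_apply, neg_neg]
  rfl

/-! #### Vacuum -/

/-- The matrix coefficient is a constant, hence rational for every functional `α`. The vacuum rules
below therefore need no membership in `𝒟_{Q(z)}`. -/
theorem ratFun_of_identity {u : V} (hu : ∀ n, Y u n = if n = -1 then 1 else 0) (w : M) :
    ratFun Y α u w = RatFunc.C (α w) := by
  refine ratFun_eq (g := fun w => RatFunc.C (α w)) (fun w => ?_) w
  ext n
  have h := iotaZero_C_mul (α w) 1 n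
  rw [mul_one, iotaZero_one] at h
  rw [h, matSeries_apply, hu]
  by_cases hn : n = 0
  · rw [if_pos hn, if_pos (by omega), mul_one]
    rfl
  · rw [if_neg hn, if_neg (by omega), mul_zero, LinearMap.zero_apply, map_zero]

theorem YR_of_identity {u : V} (hu : ∀ n, Y u n = if n = -1 then 1 else 0) (n : ℤ) :
    YR Y z u n α = if n = -1 then α else 0 := by
  ext w
  have h := iotaZero_C_mul (α w) 1 (-n - 1)
  rw [mul_one, iotaZero_one] at h
  rw [YR_apply, ratFun_of_identity hu, shiftX_C, h]
  by_cases hn : n = -1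
  · rw [if_pos hn, if_pos (by omega), mul_one]
  · rw [if_neg hn, if_neg (by omega), mul_zero, LinearMap.zero_apply]

theorem YLo_of_identity {u : V} (hu : ∀ n, Y u n = if n = -1 then 1 else 0) (n : ℤ) :
    YLo Y z α u n = if n = -1 then α else 0 := by
  ext w
  have h := iotaInf_C_mul (α w) 1 (-n - 1)
  rw [mul_one, iotaInf_one] at h
  rw [YLo_apply, ratFun_of_identity hu, shiftX_C, h]
  by_cases hn : n = -1
  · rw [if_pos hn, if_pos (by omega), mul_one]
  · rw [if_neg hn, if_neg (by omega), mul_zero, LinearMap.zero_apply]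

/-! #### Rationality -/

theorem exists_matSeries_bound (hY : ∀ w, ∃ N : ℤ, ∀ n, N ≤ n → Y v n w = 0) (w : M) :
    ∃ K : ℕ, ∀ n < -(K : ℤ), matSeries Y α v w n = 0 := by
  obtain ⟨N, hN⟩ := hY w
  exact ⟨N.toNat, fun n hn => by rw [matSeries_apply, hN _ (by omega), map_zero]⟩

theorem QLinearAt.mem_range (hz : z ≠ 0) (hY : ∀ w, ∃ N : ℤ, ∀ n, N ≤ n → Y v n w = 0)
    (h : QLinearAt Y z α v) (w : M) : matSeries Y α v w ∈ LinearMap.range iotaZero := by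
  obtain ⟨l, m, h⟩ := h
  obtain ⟨k, p, -, hp⟩ := h w
  obtain ⟨K, hK⟩ := exists_matSeries_bound (α := α) hY w
  exact exists_ratFunc hK (poleDenom_mul_powPart hz hK hp)

theorem QLinearAt.residueIdentity (hz : z ≠ 0) (hY : ∀ w, ∃ N : ℤ, ∀ n, N ≤ n → Y v n w = 0)
    (h : QLinearAt Y z α v) (w : M) : ResidueIdentity z (ratFun Y α v w) := by
  have hr := iotaZero_ratFun (h.mem_range hz hY) w
  obtain ⟨l, m, h⟩ := h
  obtain ⟨k, p, -, hp⟩ := h w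
  obtain ⟨K, hK⟩ := exists_matSeries_bound (α := α) hY w
  exact residueIdentity_of_poleDenom hz
    ((poleDenom_mul_eq_iff hK hr).2 (poleDenom_mul_powPart hz hK hp))

/-- The residue theorem for the matrix coefficients of a `Q(z)`-linear functional. -/
theorem QLinearAt.defect_eq_zero (hz : z ≠ 0) (hY : ∀ w, ∃ N : ℤ, ∀ n, N ≤ n → Y v n w = 0)
    (h : QLinearAt Y z α v) (w : M) (p r : ℤ) :
    defect z (fun n => α (Y v n w)) (fun n => YLo Y z α v (-n) w) (fun n => YR Y z v n α w) p r
      = 0 := by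
  have := h.residueIdentity hz hY w p r
  rwa [modeZero_ratFun (h.mem_range hz hY), modeInf_ratFun] at this

/-- A functional whose matrix coefficients satisfy the three-term identity with uniformly
truncated `l` and `R` is `Q(z)`-linear. -/
theorem qLinearAt_of_defect (hz : z ≠ 0) (hY : ∀ w, ∃ N : ℤ, ∀ n, N ≤ n → Y v n w = 0)
    {l R : M → ℤ → ℂ} {N₁ N₂ : ℤ} (hl : ∀ w n, N₁ ≤ n → l w n = 0) (hR : ∀ w n, N₂ ≤ n → R w n = 0)
    (h : ∀ w p r, defect z (fun n => α (Y v n w)) (l w) (R w) p r = 0) : QLinearAt Y z α v := by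
  -- Truncation of `R` bounds the pole at `-z`, and truncation of `l` bounds the pole at `∞`. Only
  -- the pole order `K` at `0` depends on `w`.
  refine ⟨N₂.toNat, N₁.toNat, fun w => ?_⟩
  obtain ⟨K, hK⟩ := exists_matSeries_bound (α := α) hY w
  have hc : (fun m : ℤ => matSeries Y α v w (-m - 1)) = fun n => α (Y v n w) := by
    ext n
    rw [matSeries_apply]
    congr 3
    ring
  obtain ⟨p, hp, e⟩ := exists_polynomial (l := N₂.toNat) (D := K + N₂.toNat + N₁.toNat) hz hK
    fun s hs => by
      -- At `p = N₂.toNat` the `R` sum is in its tail, and `s` is so negative that the `l` sum,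
      -- starting at `-(p + s)`, is too.
      have e := h w N₂.toNat s
      rw [defect, binomSum_of_tail fun n hn => hl w n (by push_cast at hs; omega),
        binomSum_of_tail fun n hn => hR w n (by omega), sub_zero, add_zero] at e
      rw [hc, e]
  exact ⟨K, p, hp, fun x hx hxz => hasSum_of_poleDenom_mul_powPart hz hK e hx hxz⟩

/-- By the residue theorem the two expansions of the rational function solve the same three-term
identity, and its solution is unique. -/
theorem eq_YLo_and_eq_YR_of_defect (hz : z ≠ 0) (hY : ∀ w, ∃ N : ℤ, ∀ n, N ≤ n → Y v n w = 0)
    (hα : QLinearAt Y z α v) {l R : ℤ → ℂ} {w : M} (hl : TailZero l) (hR : TailZero R)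
    (h : ∀ p r, defect z (fun n => α (Y v n w)) l R p r = 0) :
    (∀ n, l n = YLo Y z α v (-n) w) ∧ ∀ n, R n = YR Y z v n α w := by
  have hc := tailZero_modeZero (ratFun Y α v w)
  have hl' := tailZero_modeInf z (ratFun Y α v w)
  have hR' := tailZero_modeZero (shiftX z (ratFun Y α v w))
  rw [modeZero_ratFun (hα.mem_range hz hY)] at hc
  rw [modeInf_ratFun] at hl'
  have := eq_of_defect hc hl hR hl' hR' h (hα.defect_eq_zero hz hY w)
  exact ⟨congrFun this.1, congrFun this.2⟩

variable [AddCommGroup V] [Module ℂ V]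

theorem YL_zero (𝒱 : VOA V) (n : ℤ) : YL 𝒱 Y z v n 0 = 0 := by
  have h : YLo Y z (0 : Module.Dual ℂ M) = fun _ _ => 0 := by
    funext v n
    exact YLo_of_matSeries_eq_zero (fun _ => rfl) n
  rw [YL, h]
  simp [VOA.opp]

/-- `(Y^L_{Q(z)})^o(·,x)α` as a linear map, for a `Q(z)`-linear functional `α`. -/
def YLoₗ (Y : V →ₗ[ℂ] ℤ → Module.End ℂ M) (z : ℂ) (α : Module.Dual ℂ M)
    (h : ∀ v w, matSeries Y α v w ∈ LinearMap.range iotaZero) :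
    V →ₗ[ℂ] ℤ → Module.Dual ℂ M where
  toFun := YLo Y z α
  map_add' u v := by
    ext n w
    rw [Pi.add_apply, LinearMap.add_apply, YLo_apply, YLo_apply, YLo_apply,
      ratFun_eq (g := fun w => ratFun Y α u w + ratFun Y α v w) fun w => ?_, map_add, map_add,
      Pi.add_apply]
    rw [map_add, iotaZero_ratFun (h u), iotaZero_ratFun (h v)]
    ext n
    simp [matSeries_apply]
  map_smul' c v := by
    have hs : ∀ g : RatFunc ℂ, shiftX z (c • g) = c • shiftX z g :=
      (shiftX z).toLinearMap.map_smul c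
    ext n w
    rw [RingHom.id_apply, Pi.smul_apply, LinearMap.smul_apply, YLo_apply, YLo_apply,
      ratFun_eq (g := fun w => c • ratFun Y α v w) fun w => ?_, hs,
      map_smul, Pi.smul_apply]
    rw [map_smul, iotaZero_ratFun (h v)]
    ext n
    simp [matSeries_apply]

end QLinear

/-! ### Intertwining maps and homomorphisms -/

section Maps

variable {V A W : Type*} [AddCommGroup V] [Module ℂ V] [AddCommGroup A] [Module ℂ A]
  [AddCommGroup W] [Module ℂ W] (𝒱 : VOA V) (N : WeakModule (𝒱.toVOAData.tensor 𝒱.toVOAData) A)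

/-- `v ↦ Y'(v,x)` as a linear map. -/
def contragredientₗ (P : WeakModule 𝒱.toVOAData W) :
    V →ₗ[ℂ] ℤ → Module.End ℂ P.restrictedDual where
  toFun := contragredient 𝒱 P
  map_add' u v := funext (contragredient_add 𝒱 P u v)
  map_smul' c v := funext (contragredient_smul 𝒱 P c v)

/-- `v ↦ Y₁(v,x)` as a linear map. -/
def Y₁ₗ : V →ₗ[ℂ] ℤ → Module.End ℂ A :=
  modeₗ N.Y ∘ₗ (TensorProduct.mk ℂ V V).flip 𝒱.vac

theorem Y₁ₗ_coe : ⇑(Y₁ₗ 𝒱 N) = Y₁ 𝒱 N := rfl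

/-- `T ↦ F(Ta)` as a linear map. -/
def evalMap {E : Type*} [AddCommGroup E] [Module ℂ E] (F : A →ₗ[ℂ] E) (a : A) :
    Module.End ℂ A →ₗ[ℂ] E := F ∘ₗ LinearMap.applyₗ a

/-- `v ↦ F(Y₁(v,x)a)` as a linear map. -/
def FY₁ₗ {E : Type*} [AddCommGroup E] [Module ℂ E] (F : A →ₗ[ℂ] E) (a : A) : V →ₗ[ℂ] ℤ → E :=
  LinearMap.pi fun n => evalMap F a ∘ₗ LinearMap.proj n ∘ₗ Y₁ₗ 𝒱 N

theorem map_opp_Y₁ {E : Type*} [AddCommGroup E] [Module ℂ E] (F : A →ₗ[ℂ] E) (a : A) (v : V)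
    (n : ℤ) : F (𝒱.opp (Y₁ 𝒱 N) v n a) = 𝒱.opp (FY₁ₗ 𝒱 N F a) v n :=
  𝒱.map_opp (evalMap F a) (G := Y₁ 𝒱 N) (fun n => by rw [← Y₁ₗ_coe, map_zero]; rfl) v n

theorem opp_Y₁_tail (v : V) (a : A) : ∃ B : ℤ, ∀ n ≤ B, 𝒱.opp (Y₁ 𝒱 N) v n a = 0 := by
  obtain ⟨B, hB⟩ := 𝒱.opp_tail (FY₁ₗ 𝒱 N LinearMap.id a) (fun v => mode_tail N.Y _ a) v
  exact ⟨B, fun n hn => (map_opp_Y₁ 𝒱 N LinearMap.id a v n).trans (hB n hn)⟩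

variable (P : OrdModule 𝒱.toVOAData W) {z : ℂ}
  (F : A →ₗ[ℂ] Module.Dual ℂ P.toWeakModule.restrictedDual)

/-- The signs in the third delta function combine to `(-1)^{r+i} z^{r-i} = (-z)^{r-i}`. The modes of
`Y₁^o` are indexed in reverse, so that all three sequences vanish at large integers. -/
theorem isQzIntertwining_iff_defect :
    IsQzIntertwining 𝒱 N P.toWeakModule z F ↔
      ∀ (v : V) (a : A) (w' : P.toWeakModule.restrictedDual) (p r : ℤ),
        defect z (fun n => F a (contragredient 𝒱 P.toWeakModule v n w'))
          (fun n => F (𝒱.opp (Y₁ 𝒱 N) v (-n) a) w') (fun n => F (Y₂ 𝒱 N v n a) w') p r = 0 := by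
  refine forall₅_congr fun v a w' p r => ?_
  rw [defect, ← eq_sub_iff_add_eq, zero_sub, sub_eq_iff_eq_add, neg_add_eq_sub]
  refine iff_of_eq (congr_arg₂ _ ?_ (congr_arg₂ _ ?_ ?_)) <;>
    refine finsum_congr fun i => ?_
  · rw [one_pow, mul_one]
  · rw [one_zpow, mul_one, mul_comm ((-z) ^ i)]
    dsimp only
    rw [show -(-(p + r) + (i : ℤ)) = p + r - i by ring]
  · rw [one_pow, mul_one, ← neg_one_mul z, mul_zpow, zpow_sub₀ (by norm_num : (-1 : ℂ) ≠ 0),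
      zpow_natCast]
    rcases neg_one_pow_eq_or ℂ i with h | h <;> rw [h] <;> ring

theorem isQzIntertwining_iff (hz : z ≠ 0) :
    IsQzIntertwining 𝒱 N P.toWeakModule z F ↔
      (∀ a, F a ∈ DQ (contragredient 𝒱 P.toWeakModule) z) ∧ ∀ (v : V) (n : ℤ) (a : A),
        F (𝒱.opp (Y₁ 𝒱 N) v n a) = YLo (contragredient 𝒱 P.toWeakModule) z (F a) v n ∧
        F (Y₂ 𝒱 N v n a) = YR (contragredient 𝒱 P.toWeakModule) z v n (F a) := by
  rw [isQzIntertwining_iff_defect 𝒱 N P F]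
  have hY := contragredient_tail 𝒱 P
  constructor
  · intro h
    -- The truncation takes place in `A`, before `F` is applied, so the bounds are uniform in `w'`.
    have tails : ∀ v a, (∃ N₁ : ℤ, ∀ w' n, N₁ ≤ n → F (𝒱.opp (Y₁ 𝒱 N) v (-n) a) w' = 0) ∧
        ∃ N₂ : ℤ, ∀ w' n, N₂ ≤ n → F (Y₂ 𝒱 N v n a) w' = 0 := fun v a => by
      obtain ⟨B₁, h₁⟩ := opp_Y₁_tail 𝒱 N v a
      obtain ⟨B₂, h₂⟩ := mode_tail N.Y (𝒱.vac ⊗ₜ[ℂ] v) a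
      exact ⟨⟨-B₁, fun w' n hn => by rw [h₁ _ (by omega), map_zero, LinearMap.zero_apply]⟩,
        ⟨B₂, fun w' n hn => by rw [Y₂, h₂ n hn, map_zero, LinearMap.zero_apply]⟩⟩
    have hDQ : ∀ a, F a ∈ DQ (contragredient 𝒱 P.toWeakModule) z := fun a v => by
      obtain ⟨⟨N₁, h₁⟩, N₂, h₂⟩ := tails v a
      exact qLinearAt_of_defect hz (hY v) h₁ h₂ (h v a)
    have key := fun v a w' => eq_YLo_and_eq_YR_of_defect hz (hY v) (hDQ a v)
      ((tails v a).1.imp fun _ h n hn => h w' n hn) ((tails v a).2.imp fun _ h n hn => h w' n hn)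
      (h v a w')
    refine ⟨hDQ, fun v n a => ⟨LinearMap.ext fun w' => ?_, LinearMap.ext fun w' => ?_⟩⟩
    · have := (key v a w').1 (-n)
      rwa [neg_neg] at this
    · exact (key v a w').2 n
  · rintro ⟨hDQ, h⟩ v a w' p r
    simp only [h]
    exact (hDQ a v).defect_eq_zero hz (hY v) w' p r

variable {P F} in
theorem YQ_vac_right (v : V) (n : ℤ) (α : Module.Dual ℂ P.toWeakModule.restrictedDual) :
    YQ 𝒱 (contragredient 𝒱 P.toWeakModule) z v 𝒱.vac n α
      = YL 𝒱 (contragredient 𝒱 P.toWeakModule) z v n α := by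
  rw [YQ, finsum_eq_single _ n fun i hi => ?_]
  · rw [YR_of_identity (contragredient_vac 𝒱 P.toWeakModule), if_pos (by ring)]
  · rw [YR_of_identity (contragredient_vac 𝒱 P.toWeakModule), if_neg (by omega), YL_zero]

variable {P F} in
theorem YL_vac (n : ℤ) (α : Module.Dual ℂ P.toWeakModule.restrictedDual) :
    YL 𝒱 (contragredient 𝒱 P.toWeakModule) z 𝒱.vac n α = if n = -1 then α else 0 := by
  rw [YL, 𝒱.opp_vac fun n => YLo_of_matSeries_eq_zero (fun w => ?_) n,
    YLo_of_identity (contragredient_vac 𝒱 P.toWeakModule)]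
  · exact if_congr (by omega) rfl rfl
  · ext n
    change α ((contragredientₗ 𝒱 P.toWeakModule) 0 (-n - 1) w) = 0
    rw [map_zero, Pi.zero_apply, LinearMap.zero_apply, map_zero]

variable {P F} in
theorem YQ_vac_left (v : V) (n : ℤ) (α : Module.Dual ℂ P.toWeakModule.restrictedDual) :
    YQ 𝒱 (contragredient 𝒱 P.toWeakModule) z 𝒱.vac v n α
      = YR (contragredient 𝒱 P.toWeakModule) z v n α := by
  rw [YQ, finsum_eq_single _ (-1) fun i hi => ?_]
  · rw [YL_vac, if_pos rfl]
    congr 1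
    ring
  · rw [YL_vac, if_neg hi]

/-- Tensors with a vacuum factor isolate `Y^L` and `Y^R`. In the other direction the product formula
in `A` is carried termwise through `F`, the sum being finite already in `A`. -/
theorem isHomIntoDQ_iff :
    IsHomIntoDQ 𝒱 N P.toWeakModule z F ↔
      (∀ a, F a ∈ DQ (contragredient 𝒱 P.toWeakModule) z) ∧ ∀ (v : V) (n : ℤ) (a : A),
        F (Y₁ 𝒱 N v n a) = YL 𝒱 (contragredient 𝒱 P.toWeakModule) z v n (F a) ∧
        F (Y₂ 𝒱 N v n a) = YR (contragredient 𝒱 P.toWeakModule) z v n (F a) := by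
  refine and_congr_right fun _ => ⟨fun h v n a => ⟨?_, ?_⟩, fun h s n a => ?_⟩
  · have := h [(v, 𝒱.vac)] n a
    simp only [List.map_cons, List.map_nil, List.sum_cons, List.sum_nil, add_zero] at this
    rw [YQ_vac_right] at this
    exact this
  · have := h [(𝒱.vac, v)] n a
    simp only [List.map_cons, List.map_nil, List.sum_cons, List.sum_nil, add_zero] at this
    rw [YQ_vac_left] at this
    exact this
  · induction s with
    | nil =>
      change F (modeₗ N.Y 0 n a) = 0
      rw [map_zero, Pi.zero_apply, LinearMap.zero_apply, map_zero]
    | cons t s ih =>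
      rw [List.map_cons, List.map_cons, List.sum_cons, List.sum_cons, ← ih, ← modeₗ_apply, map_add,
        Pi.add_apply, LinearMap.add_apply, map_add, modeₗ_apply, modeₗ_apply, mode_tmul,
        map_finsum F (finite_support_Y₁_Y₂ 𝒱 N t.1 t.2 n a), YQ]
      congr 1
      refine finsum_congr fun i => ?_
      rw [(h _ _ _).1, (h _ _ _).2]

/-- Both directions apply `(G^o)^o = G`. Membership in `𝒟_{Q(z)}` enters because this rule needs
linearity in `v`, which `YLo` has once all matrix coefficients are rational. -/
theorem forall_opp_Y₁_iff (hz : z ≠ 0) (a : A)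
    (ha : F a ∈ DQ (contragredient 𝒱 P.toWeakModule) z) :
    (∀ v n, F (𝒱.opp (Y₁ 𝒱 N) v n a) = YLo (contragredient 𝒱 P.toWeakModule) z (F a) v n) ↔
      ∀ v n, F (Y₁ 𝒱 N v n a) = YL 𝒱 (contragredient 𝒱 P.toWeakModule) z v n (F a) := by
  have hr := fun v => (ha v).mem_range hz (contragredient_tail 𝒱 P v)
  constructor <;> intro h v n
  · have e : YLo (contragredient 𝒱 P.toWeakModule) z (F a) = 𝒱.opp (FY₁ₗ 𝒱 N F a) := by
      funext v n
      rw [← h, map_opp_Y₁]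
    rw [YL, e, 𝒱.opp_opp]
    rfl
  · have e : ⇑(FY₁ₗ 𝒱 N F a)
        = 𝒱.opp (YLoₗ (contragredientₗ 𝒱 P.toWeakModule) z (F a) hr) := by
      funext v n
      exact h v n
    rw [map_opp_Y₁, e, 𝒱.opp_opp]
    rfl

end Maps

end QzMaps

end

/-! ### Equivalence of intertwining maps and homomorphisms -/

theorem theorem4p2 {V A W : Type*} [AddCommGroup V] [Module ℂ V] [AddCommGroup A] [Module ℂ A]
    [AddCommGroup W] [Module ℂ W] (𝒱 : QzMaps.VOA V)
    (N : QzMaps.OrdModule (𝒱.toVOAData.tensor 𝒱.toVOAData) A)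
    (P : QzMaps.OrdModule 𝒱.toVOAData W) (z : ℂ) (hz : z ≠ 0)
    (F : A →ₗ[ℂ] Module.Dual ℂ P.toWeakModule.restrictedDual) :
    QzMaps.IsQzIntertwining 𝒱 N.toWeakModule P.toWeakModule z F ↔
      QzMaps.IsHomIntoDQ 𝒱 N.toWeakModule P.toWeakModule z F := by
  rw [QzMaps.isQzIntertwining_iff 𝒱 N.toWeakModule P F hz, QzMaps.isHomIntoDQ_iff]
  refine and_congr_right fun hDQ => ?_
  have h := fun a => QzMaps.forall_opp_Y₁_iff 𝒱 N.toWeakModule P F hz a (hDQ a)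
  exact ⟨fun H v n a => ⟨(h a).1 (fun v n => (H v n a).1) v n, (H v n a).2⟩,
    fun H v n a => ⟨(h a).2 (fun v n => (H v n a).1) v n, (H v n a).2⟩⟩
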